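/- Let $\Omega\subset\mathbb R^3$ be a bounded domain with smooth boundary, $-\Delta$ the Laplacian on $L^2(\Omega)$ (complex-valued functions) with Dirichlet boundary conditions, and for an eigenvalue $\mu$ of $-\Delta$ let $\Pi_\mu$ be the orthogonal projector of $L^2(\Omega)$ onto the $\mu$-eigenspace. For a function $F$ put $F(-\Delta)u=\sum_\mu F(\mu)\Pi_\mu u$. For $\lambda\ge 0$ let $\mathbf P_\lambda$ be the orthogonal projector onto the closed span of the eigenfunctions with eigenvalue $\mu$ such that $\sqrt{\mu}\in[\lambda,\lambda+1)$. For $s\ge0$ let $H^s(\Omega)$ be the space of $u\in L^2(\Omega)$ with $\|u\|_{H^s(\Omega)}^2:=\sum_\mu(1+\mu)^s\|\Pi_\mu u\|^2<\infty$, where $\|\cdot\|$ is the norm of $L^2(\Omega)$. Let $\gamma>0$, $\alpha\in(0,\tfrac12)$, $2\le q<\infty$, $\delta>0$ and $M\in\mathbb R$. Assume that $$\|\mathbf P_\lambda u\|_{L^q(\Omega)}\le M\lambda^\delta\|u\|\qquad\text{for all }\lambda\ge1\text{ and }u\in L^2(\Omega).$$ Then for every $u_0\in H^{\delta+\frac12-\frac1q}(\Omega)$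 the function $$v(t,x)=\Big(e^{it\sqrt{-\Delta-\frac{\gamma^2}{4}(-\Delta)^{2\alpha}}}u_0\Big)(x)$$ (with the principal square root, $\sqrt{-r}=i\sqrt r$ for $r>0$) belongs to $L^q([0,2\pi]\times\Omega)$ (that is, $t\mapsto v(t,\cdot)$ has a jointly measurable representative in this space), and $$\|v\|_{L^q([0,2\pi]\times\Omega)}\le C\,\|u_0\|_{H^{\delta+\frac12-\frac1q}(\Omega)},$$ where $C>0$ depends only on $\gamma,\alpha,q,\delta$ and $M$, and not on $u_0$ or $\Omega$. -/

import Mathlib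

open MeasureTheory Set
open scoped ENNReal ContDiff

noncomputable section

namespace FracWave

/-- The ambient space `ℝ³` with its Euclidean norm. -/
abbrev E3 : Type := EuclideanSpace ℝ (Fin 3)

/-- A bounded domain of `ℝ³` (nonempty, open, connected) with smooth boundary: near each boundary
point the domain is the sublevel set `{ρ < 0}` of a smooth function with nonvanishing gradient. -/
structure IsSmoothBoundedDomain (Ω : Set E3) : Prop where
  isOpen : IsOpen Ω
  isConnected : IsConnected Ω
  isBounded : Bornology.IsBounded Ω
  smooth_boundary : ∀ x ∈ frontier Ω, ∃ (U : Set E3) (ρ : E3 → ℝ),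
    IsOpen U ∧ x ∈ U ∧ ContDiffOn ℝ ∞ ρ U ∧ fderiv ℝ ρ x ≠ 0 ∧
      Ω ∩ U = {y ∈ U | ρ y < 0}

/-- The complex Hilbert space `L²(Ω)`. -/
abbrev L2 (Ω : Set E3) : Type := Lp ℂ 2 (volume.restrict Ω)

/-- Test functions: `φ ∈ C_c^∞(Ω; ℂ)`. -/
structure IsTestFunction (Ω : Set E3) (φ : E3 → ℂ) : Prop where
  contDiff : ContDiff ℝ ∞ φ
  hasCompactSupport : HasCompactSupport φ
  tsupport_subset : tsupport φ ⊆ Ω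

/-- The partial derivative `∂ᵢφ`. -/
def partialDeriv (i : Fin 3) (φ : E3 → ℂ) (x : E3) : ℂ :=
  fderiv ℝ φ x (EuclideanSpace.single i 1)

/-- The pairs `(φ, ∇φ)`, `φ ∈ C_c^∞(Ω; ℂ)`, as elements of `L²(Ω) × L²(Ω)³`. -/
def testGraph (Ω : Set E3) : Submodule ℂ (L2 Ω × (Fin 3 → L2 Ω)) where
  carrier := {p | ∃ φ : E3 → ℂ, IsTestFunction Ω φ ∧ p.1 =ᵐ[volume.restrict Ω] φ ∧
    ∀ i, p.2 i =ᵐ[volume.restrict Ω] partialDeriv i φ}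
  zero_mem' := by
    refine ⟨0, ⟨contDiff_const, HasCompactSupport.zero, by simp⟩, Lp.coeFn_zero _ _ _, fun i => ?_⟩
    refine (Lp.coeFn_zero _ _ _).trans (Filter.EventuallyEq.of_eq ?_)
    funext x
    simp [partialDeriv]
  add_mem' := by
    rintro p p' ⟨φ, hφ, h1, h2⟩ ⟨φ', hφ', h1', h2'⟩
    refine ⟨φ + φ', ⟨hφ.contDiff.add hφ'.contDiff,
      hφ.hasCompactSupport.add hφ'.hasCompactSupport, ?_⟩, ?_, fun i => ?_⟩
    · exact (tsupport_add φ φ').trans (union_subset hφ.tsupport_subset hφ'.tsupport_subset)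
    · exact (Lp.coeFn_add _ _).trans (h1.add h1')
    · refine ((Lp.coeFn_add _ _).trans ((h2 i).add (h2' i))).trans
        (Filter.EventuallyEq.of_eq ?_)
      funext x
      have d := (hφ.contDiff.differentiable (by simp)) x
      have d' := (hφ'.contDiff.differentiable (by simp)) x
      simp [partialDeriv, fderiv_add d d']
  smul_mem' := by
    rintro c p ⟨φ, hφ, h1, h2⟩
    refine ⟨c • φ, ⟨contDiff_const.smul hφ.contDiff, hφ.hasCompactSupport.smul_left, ?_⟩, ?_,
      fun i => ?_⟩
    · exact (closure_mono (Function.support_const_smul_subset c φ)).trans hφ.tsupport_subset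
    · exact (Lp.coeFn_smul _ _).trans (h1.const_smul c)
    · refine ((Lp.coeFn_smul _ _).trans ((h2 i).const_smul c)).trans
        (Filter.EventuallyEq.of_eq ?_)
      funext x
      have d := (hφ.contDiff.differentiable (by simp)) x
      simp [partialDeriv, fderiv_const_smul d c]

/-- `H¹₀(Ω)`, as the set of pairs `(u, ∇u)`: the closure in the `H¹` norm of the pairs `(φ, ∇φ)`
with `φ ∈ C_c^∞(Ω)`. -/
def h10Graph (Ω : Set E3) : Submodule ℂ (L2 Ω × (Fin 3 → L2 Ω)) :=
  (testGraph Ω).topologicalClosure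

/-- `u` lies in the domain of the Dirichlet Laplacian and `-Δu = f`: `u ∈ H¹₀(Ω)` and
`∫ ∇u · ∇w̄ = ∫ f w̄` for all `w ∈ H¹₀(Ω)`. -/
def IsNegDirichletLaplacian (Ω : Set E3) (u f : L2 Ω) : Prop :=
  ∃ g : Fin 3 → L2 Ω, (u, g) ∈ h10Graph Ω ∧
    ∀ p ∈ h10Graph Ω, ∑ i, inner ℂ (p.2 i) (g i) = inner ℂ p.1 f

/-- The eigenspace `ker(-Δ - μ)` of the Dirichlet Laplacian. -/
def eigenspace (Ω : Set E3) (μ : ℝ) : Submodule ℂ (L2 Ω) where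
  carrier := {u | IsNegDirichletLaplacian Ω u ((μ : ℂ) • u)}
  zero_mem' := ⟨0, (h10Graph Ω).zero_mem, by simp⟩
  add_mem' := by
    rintro u u' ⟨g, hg, h⟩ ⟨g', hg', h'⟩
    refine ⟨g + g', (h10Graph Ω).add_mem hg hg', fun p hp => ?_⟩
    simp only [Pi.add_apply, inner_add_right, Finset.sum_add_distrib, smul_add, h p hp, h' p hp]
  smul_mem' := by
    rintro c u ⟨g, hg, h⟩
    refine ⟨c • g, (h10Graph Ω).smul_mem c hg, fun p hp => ?_⟩
    simp only [Pi.smul_apply, inner_smul_right, ← Finset.mul_sum, h p hp]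
    ring

/-- The closed span of all eigenfunctions of `-Δ` with eigenvalue in `S`. -/
def spectralSubspace (Ω : Set E3) (S : Set ℝ) : Submodule ℂ (L2 Ω) :=
  (⨆ μ ∈ S, eigenspace Ω μ).topologicalClosure

instance (Ω : Set E3) (S : Set ℝ) : CompleteSpace (spectralSubspace Ω S) :=
  (Submodule.isClosed_topologicalClosure _).completeSpace_coe

/-- The spectral projector `𝟏_S(-Δ)`, the orthogonal projection of `L²(Ω)` onto the
eigenfunctions with eigenvalue in `S`. (The spectrum of the Dirichlet Laplacian of a bounded domain
is discrete, so that these projections are its whole spectral resolution.) -/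
def spectralProj (Ω : Set E3) (S : Set ℝ) : L2 Ω →L[ℂ] L2 Ω :=
  (spectralSubspace Ω S).starProjection

/-- The spectral cluster projector `𝐏_l`, onto the eigenfunctions with `√μ ∈ [l, l + 1)`. -/
def clusterProj (Ω : Set E3) (l : ℝ) : L2 Ω →L[ℂ] L2 Ω :=
  spectralProj Ω {μ | 0 ≤ μ ∧ √μ ∈ Ico l (l + 1)}

/-- The functional calculus of the Dirichlet Laplacian:
`F(-Δ) u = ∑_μ F(μ) Π_μ u`, the sum running over the eigenvalues (`Π_μ = 0` for all other `μ`). -/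
def spectralApply (Ω : Set E3) (F : ℝ → ℂ) (u : L2 Ω) : L2 Ω :=
  ∑' μ : ℝ, F μ • spectralProj Ω {μ} u

/-- The norm of `H^s(Ω)`, the domain of `(-Δ)^{s/2}`:
`‖u‖²_{H^s} = ∑_μ (1 + μ)^s ‖Π_μ u‖²`, with value `∞` if `u ∉ H^s(Ω)`. -/
def sobolevNorm (Ω : Set E3) (s : ℝ) (u : L2 Ω) : ℝ≥0∞ :=
  (∑' μ : ℝ, ENNReal.ofReal ((1 + μ) ^ s) * ‖spectralProj Ω {μ} u‖ₑ ^ 2) ^ (1 / 2 : ℝ)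

/-- The symbol `√(μ - (γ²/4) μ^{2α})`, the principal square root (`i √|·|` where the radicand is
negative, which can only happen for small `μ`). -/
def waveSymbol (γ α : ℝ) (μ : ℝ) : ℂ :=
  ((μ - γ ^ 2 / 4 * μ ^ (2 * α) : ℝ) : ℂ) ^ (1 / 2 : ℂ)

/-- `e^{it√(-Δ - (γ²/4)(-Δ)^{2α})} u₀`. -/
def waveEvol (Ω : Set E3) (γ α : ℝ) (t : ℝ) (u₀ : L2 Ω) : L2 Ω :=
  spectralApply Ω (fun μ => Complex.exp (Complex.I * t * waveSymbol γ α μ)) u₀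

end FracWave

end

/-! Up to a bounded error, the symbol `ω(μ) = waveSymbol γ α μ` is a natural number `m(μ) = waveFreq
γ α μ` (`exists_norm_waveSymbol_sub_le`). If `ω` were equal to `m`, the flow would be a
trigonometric polynomial in `t` with coefficients in functions of `x`. The embedding `H^{1/2-1/q} ⊂
L^q` on the circle (`exists_lintegral_trigPoly_le`) followed by Minkowski in `L^{q/2}` then reduces
the claim to bounding, for each `m`, the `L^q(Ω)` norm of the block of eigenfunctions with frequency
`m`. Since `2α < 1`, the radicand grows like `μ`, so a block meets boundedly many spectral clusters
(`exists_card_image_floor_sqrt_le`), and the cluster estimate applies to each. The time weight gives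
`1/2 - 1/q` derivatives and the clusters give `δ` (`weight_le`).

The error `e^{it(ω-m)}` is removed by its Taylor series: each term is a power of `t` times an
integer-frequency flow with multiplier `(ω-m)^j`, and the terms sum to a factor `e^{2πR}`
(`exists_eLpNorm_waveSum_le`).

The cluster hypothesis starts at `λ = 1`. Below that, the iterates of `-Δ` on a spectral sum do not
grow in `L²`, and Moser iteration based on the Sobolev inequality of `ℝ³` bounds every `L^q` norm
with a constant independent of the domain (`exists_eLpNorm_le_of_low`).

All estimates are for finite sums of eigenfunctions. They make the spectral series summable in `L^q`
of space-time, and its sum is identified with the flow at almost every time through a.e. convergent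
subsequences. -/

noncomputable section

namespace FracWave

open Filter Topology

/-! ### Chain rule in `H¹₀` -/

section ChainRule

variable {α : Type*} [MeasurableSpace α] {ν : Measure α} {T : ℂ → ℂ} {K : NNReal}

theorem memLp_fderiv_comp (hT : ContDiff ℝ ∞ T) (hK : ∀ z, ‖fderiv ℝ T z‖ ≤ K)
    (u g : Lp ℂ 2 ν) : MemLp (fun x => fderiv ℝ T (u x) (g x)) 2 ν := by
  have hc : Continuous (fderiv ℝ T) := hT.continuous_fderiv (by simp)
  refine MemLp.of_le_mul (c := K) (Lp.memLp g) ?_ (ae_of_all _ fun x => ?_)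
  · exact (ContinuousLinearMap.apply ℝ ℂ).aestronglyMeasurable_comp₂
      (Lp.aestronglyMeasurable g)
      (hc.comp_aestronglyMeasurable (Lp.aestronglyMeasurable u))
  · exact (ContinuousLinearMap.le_opNorm _ _).trans
      (mul_le_mul_of_nonneg_right (hK _) (norm_nonneg _))

/-- The function `DT(u) g`, the gradient component of `T ∘ u` when `g` is one of `u`. -/
def fderivComp (hT : ContDiff ℝ ∞ T) (hK : ∀ z, ‖fderiv ℝ T z‖ ≤ K) (u g : Lp ℂ 2 ν) :
    Lp ℂ 2 ν :=
  (memLp_fderiv_comp hT hK u g).toLp _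

theorem coeFn_fderivComp (hT : ContDiff ℝ ∞ T) (hK : ∀ z, ‖fderiv ℝ T z‖ ≤ K)
    (u g : Lp ℂ 2 ν) :
    fderivComp hT hK u g =ᵐ[ν] fun x => fderiv ℝ T (u x) (g x) :=
  MemLp.coeFn_toLp _

theorem norm_fderivComp_sub_le (hT : ContDiff ℝ ∞ T) (hK : ∀ z, ‖fderiv ℝ T z‖ ≤ K)
    (u g g' : Lp ℂ 2 ν) :
    ‖fderivComp hT hK u g - fderivComp hT hK u g'‖ ≤ K * ‖g - g'‖ := by
  refine Lp.norm_le_mul_norm_of_ae_le_mul ?_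
  filter_upwards [Lp.coeFn_sub (fderivComp hT hK u g) (fderivComp hT hK u g'),
    coeFn_fderivComp hT hK u g, coeFn_fderivComp hT hK u g', Lp.coeFn_sub g g']
    with x h1 h2 h3 h4
  rw [h1, h4, Pi.sub_apply, Pi.sub_apply, h2, h3, ← map_sub]
  exact (ContinuousLinearMap.le_opNorm _ _).trans
      (mul_le_mul_of_nonneg_right (hK _) (norm_nonneg _))

/-- `DT` is bounded and continuous but need not be Lipschitz, so convergence of `u n` in `L²` is not
used directly: a.e. convergence and domination by `(2K|g|)²` are. -/
theorem tendsto_fderivComp_left (hT : ContDiff ℝ ∞ T) (hK : ∀ z, ‖fderiv ℝ T z‖ ≤ K)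
    {u : ℕ → Lp ℂ 2 ν} {u' g : Lp ℂ 2 ν}
    (hu : ∀ᵐ x ∂ν, Tendsto (fun n => u n x) atTop (𝓝 (u' x))) :
    Tendsto (fun n => fderivComp hT hK (u n) g) atTop (𝓝 (fderivComp hT hK u' g)) := by
  have hc : Continuous (fderiv ℝ T) := hT.continuous_fderiv (by simp)
  rw [Lp.tendsto_Lp_iff_tendsto_eLpNorm']
  have key : Tendsto (fun n => ∫⁻ x, ‖(fderivComp hT hK (u n) g - fderivComp hT hK u' g :
      Lp ℂ 2 ν) x‖ₑ ^ (2 : ℝ) ∂ν) atTop (𝓝 (∫⁻ x, 0 ∂ν)) := by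
    refine tendsto_lintegral_of_dominated_convergence'
      (fun x => ENNReal.ofReal (2 * K) ^ (2 : ℝ) * ‖g x‖ₑ ^ (2 : ℝ)) (fun n => ?_) (fun n => ?_)
      ?_ ?_
    · exact (Lp.aestronglyMeasurable _).enorm.pow_const _
    · filter_upwards [Lp.coeFn_sub (fderivComp hT hK (u n) g) (fderivComp hT hK u' g),
        coeFn_fderivComp hT hK (u n) g, coeFn_fderivComp hT hK u' g] with x h1 h2 h3
      rw [h1, Pi.sub_apply, h2, h3, ← ENNReal.mul_rpow_of_nonneg _ _ (by norm_num)]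
      gcongr
      rw [← ofReal_norm, ← ofReal_norm, ← ENNReal.ofReal_mul (by positivity)]
      refine ENNReal.ofReal_le_ofReal ?_
      rw [← sub_apply]
      refine (ContinuousLinearMap.le_opNorm _ _).trans
        (mul_le_mul_of_nonneg_right ?_ (norm_nonneg _))
      exact (norm_sub_le _ _).trans (by linarith [hK (u n x), hK (u' x)])
    · rw [lintegral_const_mul'' _ ((Lp.aestronglyMeasurable g).enorm.pow_const _)]
      refine ENNReal.mul_ne_top (by finiteness) ?_
      have := lintegral_rpow_enorm_lt_top_of_eLpNorm_lt_top (p := 2) (by simp) (by simp)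
        (Lp.memLp g).eLpNorm_lt_top
      simpa using this.ne
    · have h1 : ∀ᵐ x ∂ν, ∀ n, (fderivComp hT hK (u n) g - fderivComp hT hK u' g :
          Lp ℂ 2 ν) x = fderiv ℝ T (u n x) (g x) - fderiv ℝ T (u' x) (g x) := by
        rw [ae_all_iff]
        intro n
        filter_upwards [Lp.coeFn_sub (fderivComp hT hK (u n) g) (fderivComp hT hK u' g),
          coeFn_fderivComp hT hK (u n) g, coeFn_fderivComp hT hK u' g] with x h1 h2 h3
        rw [h1, Pi.sub_apply, h2, h3]
      filter_upwards [h1, hu] with x hx hux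
      simp only [hx]
      have h2 : Tendsto (fun n => fderiv ℝ T (u n x) (g x) - fderiv ℝ T (u' x) (g x)) atTop
          (𝓝 0) := by
        have := (((hc.clm_apply (continuous_const (y := g x))).tendsto (u' x)).comp hux)
        simpa using this.sub_const (fderiv ℝ T (u' x) (g x))
      have h3 := (ENNReal.continuous_rpow_const (y := 2)).tendsto 0 |>.comp
        ((continuous_enorm.tendsto (0 : ℂ)).comp h2 |>.trans_eq (by simp))
      simpa [Function.comp_def] using h3
  have key2 := (ENNReal.continuous_rpow_const (y := 1 / 2)).tendsto 0 |>.comp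
    (key.trans_eq (by simp))
  refine Tendsto.congr (fun n => ?_) (key2.trans_eq (by simp))
  rw [← eLpNorm_congr_ae (Lp.coeFn_sub _ _),
    eLpNorm_eq_lintegral_rpow_enorm_toReal (p := 2) (by simp) (by simp)]
  simp only [Function.comp_apply, ENNReal.toReal_ofNat]

/-- Chain rule in `H¹₀`. -/
theorem comp_mem_h10Graph {Ω : Set E3} (hT : ContDiff ℝ ∞ T) (hK : ∀ z, ‖fderiv ℝ T z‖ ≤ K)
    (hL : LipschitzWith K T) (T0 : T 0 = 0) {u : L2 Ω} {g : Fin 3 → L2 Ω}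
    (h : (u, g) ∈ h10Graph Ω) :
    (hL.compLp T0 u, fun i => fderivComp hT hK u (g i)) ∈ h10Graph Ω := by
  obtain ⟨p, hp, hlim⟩ := mem_closure_iff_seq_limit.1 h
  have h1 : Tendsto (fun n => (p n).1) atTop (𝓝 u) := (continuous_fst.tendsto _).comp hlim
  have h2 : ∀ i, Tendsto (fun n => (p n).2 i) atTop (𝓝 (g i)) := fun i =>
    (((continuous_apply i).comp continuous_snd).tendsto _).comp hlim
  obtain ⟨ns, hns, hae⟩ := (tendstoInMeasure_of_tendsto_Lp h1).exists_seq_tendsto_ae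
  refine mem_closure_iff_seq_limit.2 ⟨fun n => (hL.compLp T0 (p (ns n)).1,
    fun i => fderivComp hT hK (p (ns n)).1 ((p (ns n)).2 i)), fun n => ?_, ?_⟩
  · obtain ⟨φ, hφ, e1, e2⟩ := hp (ns n)
    refine ⟨T ∘ φ, ⟨hT.comp hφ.contDiff, hφ.hasCompactSupport.comp_left T0, ?_⟩, ?_, fun i => ?_⟩
    · exact (closure_mono (Function.support_comp_subset T0 φ)).trans hφ.tsupport_subset
    · filter_upwards [hL.coeFn_compLp T0 (p (ns n)).1, e1] with x a b
      rw [a, Function.comp_apply, b, Function.comp_apply]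
    · filter_upwards [coeFn_fderivComp hT hK (p (ns n)).1 ((p (ns n)).2 i), e1, e2 i]
        with x a b c
      rw [a, b, c, partialDeriv, partialDeriv, fderiv_comp]
      · rfl
      · exact hT.differentiable (by simp) _
      · exact hφ.contDiff.differentiable (by simp) _
  · refine Tendsto.prodMk_nhds ?_ ?_
    · exact ((hL.continuous_compLp T0).tendsto _).comp (h1.comp hns.tendsto_atTop)
    · refine tendsto_pi_nhds.2 fun i => ?_
      have a := tendsto_fderivComp_left hT hK (g := g i) hae
      -- Both arguments of `DT(u) g` move. Replacing the gradient costs at most `K` times its `L²`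
      -- error, uniformly in `u`; moving `u` with `g` fixed is the previous limit.
      have b : Tendsto (fun n => fderivComp hT hK (p (ns n)).1 ((p (ns n)).2 i) -
          fderivComp hT hK (p (ns n)).1 (g i)) atTop (𝓝 0) := by
        refine squeeze_zero_norm (fun n => norm_fderivComp_sub_le hT hK _ _ _) ?_
        have := ((h2 i).comp hns.tendsto_atTop).sub_const (g i) |>.norm.const_mul (K : ℝ)
        simpa using this
      simpa using b.add a

end ChainRule

/-! ### Sobolev inequality on `H¹₀`, uniform in the domain -/

section Sobolev

/-- The constant of the Sobolev inequality `‖φ‖₆ ≤ C ‖∇φ‖₂` on `ℝ³`. -/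
def sobolevConst : NNReal :=
  SNormLESNormFDerivOfEqConst ℂ (volume : Measure E3) (2 : NNReal)

theorem norm_fderiv_le_sum_partialDeriv (φ : E3 → ℂ) (x : E3) :
    ‖fderiv ℝ φ x‖ ≤ ∑ i, ‖partialDeriv i φ x‖ := by
  refine ContinuousLinearMap.opNorm_le_bound _ (by positivity) fun v => ?_
  have hv : v = ∑ i, v i • EuclideanSpace.single i (1 : ℝ) := by
    ext j
    simp [Finset.sum_apply, Pi.single_apply]
  conv_lhs => rw [hv, map_sum]
  refine (norm_sum_le _ _).trans ?_
  rw [Finset.sum_mul]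
  refine Finset.sum_le_sum fun i _ => ?_
  rw [map_smul, norm_smul, mul_comm]
  exact mul_le_mul_of_nonneg_left (PiLp.norm_apply_le v i) (norm_nonneg _)

/-- A test function and its gradient vanish outside `Ω`, so the inequality on all of `ℝ³` applies
and its constant does not see `Ω`. -/
theorem IsTestFunction.eLpNorm_six_le {Ω : Set E3} {φ : E3 → ℂ} (hφ : IsTestFunction Ω φ) :
    eLpNorm φ 6 (volume.restrict Ω) ≤
      sobolevConst * ∑ i, eLpNorm (partialDeriv i φ) 2 (volume.restrict Ω) := by
  have hs : Function.support φ ⊆ Ω := (subset_tsupport φ).trans hφ.tsupport_subset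
  have hd : ∀ i, Function.support (partialDeriv i φ) ⊆ Ω := fun i x hx => by
    refine hφ.tsupport_subset (support_fderiv_subset ℝ ?_)
    intro h
    exact hx (by simp [partialDeriv, h])
  have h1 := eLpNorm_le_eLpNorm_fderiv_of_eq (volume : Measure E3) (hφ.contDiff.of_le (by simp))
    hφ.hasCompactSupport (p := 2) (p' := 6) (by norm_num) (by simp)
    (by simp; norm_num)
  rw [eLpNorm_restrict_eq_of_support_subset hs]
  simp only [eLpNorm_restrict_eq_of_support_subset (hd _)]
  refine h1.trans ?_
  unfold sobolevConst
  gcongr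
  have hm : ∀ i, AEStronglyMeasurable (fun x => ‖partialDeriv i φ x‖) (volume : Measure E3) :=
    fun i => ((hφ.contDiff.continuous_fderiv (by simp)).clm_apply
      continuous_const).norm.aestronglyMeasurable
  calc eLpNorm (fderiv ℝ φ) 2 volume
      ≤ eLpNorm (∑ i, fun x => ‖partialDeriv i φ x‖) 2 volume := by
        refine eLpNorm_mono_real fun x => ?_
        simpa using norm_fderiv_le_sum_partialDeriv φ x
    _ ≤ ∑ i, eLpNorm (fun x => ‖partialDeriv i φ x‖) 2 volume :=
        eLpNorm_sum_le (fun i _ => hm i) (by norm_num)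
    _ = _ := by simp only [eLpNorm_norm]

/-- Test functions are dense, and the `L⁶` norm is lower semicontinuous along an a.e. convergent
subsequence by Fatou. -/
theorem eLpNorm_six_le_of_mem_h10Graph {Ω : Set E3} {u : L2 Ω} {g : Fin 3 → L2 Ω}
    (h : (u, g) ∈ h10Graph Ω) :
    eLpNorm u 6 (volume.restrict Ω) ≤
      sobolevConst * ∑ i, eLpNorm (g i) 2 (volume.restrict Ω) := by
  obtain ⟨p, hp, hlim⟩ := mem_closure_iff_seq_limit.1 h
  have h1 : Tendsto (fun n => (p n).1) atTop (𝓝 u) := (continuous_fst.tendsto _).comp hlim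
  have h2 : ∀ i, Tendsto (fun n => (p n).2 i) atTop (𝓝 (g i)) := fun i =>
    (((continuous_apply i).comp continuous_snd).tendsto _).comp hlim
  obtain ⟨ns, hns, hae⟩ := (tendstoInMeasure_of_tendsto_Lp h1).exists_seq_tendsto_ae
  refine (Lp.eLpNorm_lim_le_liminf_eLpNorm (fun n => Lp.aestronglyMeasurable _) _ hae).trans ?_
  have h3 : ∀ n, eLpNorm ((p n).1) 6 (volume.restrict Ω) ≤
      sobolevConst * ∑ i, eLpNorm ((p n).2 i) 2 (volume.restrict Ω) := fun n => by
    obtain ⟨φ, hφ, e1, e2⟩ := hp n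
    rw [eLpNorm_congr_ae e1]
    simp only [eLpNorm_congr_ae (e2 _)]
    exact hφ.eLpNorm_six_le
  have h4 : Tendsto (fun n => (sobolevConst : ℝ≥0∞) *
      ∑ i, eLpNorm ((p (ns n)).2 i) 2 (volume.restrict Ω)) atTop
      (𝓝 (sobolevConst * ∑ i, eLpNorm (g i) 2 (volume.restrict Ω))) := by
    refine ENNReal.Tendsto.const_mul (tendsto_finsetSum _ fun i _ => ?_) (Or.inr (by simp))
    have := (continuous_enorm.tendsto (g i)).comp ((h2 i).comp hns.tendsto_atTop)
    simpa only [Lp.enorm_def, Function.comp_def] using this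
  rw [← h4.liminf_eq]
  exact liminf_le_liminf (Eventually.of_forall fun n => h3 (ns n))

end Sobolev

/-! ### Truncated power nonlinearities -/

section PowMap

/-- A bounded, increasing, smooth approximation of `s` on `[0, ∞)`. -/
def satur (ε s : ℝ) : ℝ := s / (1 + ε * s)

/-- A globally Lipschitz approximation of `z ↦ |z|^{2j} z`. -/
def powMap (ε : ℝ) (j : ℕ) (z : ℂ) : ℂ := (satur ε (‖z‖ ^ 2) ^ j) • z

variable {ε : ℝ} (hε : 0 < ε) (j : ℕ)

include hε

theorem satur_nonneg {s : ℝ} (hs : 0 ≤ s) : 0 ≤ satur ε s := by unfold satur; positivity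

theorem satur_le_self {s : ℝ} (hs : 0 ≤ s) : satur ε s ≤ s :=
  div_le_self hs (by nlinarith)

theorem satur_le_inv {s : ℝ} (hs : 0 ≤ s) : satur ε s ≤ ε⁻¹ := by
  unfold satur
  rw [div_le_iff₀ (by positivity), mul_add, inv_mul_cancel_left₀ hε.ne']
  have := inv_pos.2 hε
  linarith

theorem hasDerivAt_satur {s : ℝ} (hs : 0 ≤ s) :
    HasDerivAt (satur ε) (1 / (1 + ε * s) ^ 2) s := by
  have h : 1 + ε * s ≠ 0 := by positivity
  have : HasDerivAt (satur ε) _ s :=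
    (hasDerivAt_id s).div (((hasDerivAt_id s).const_mul ε).const_add 1) h
  exact this.congr_deriv (by simp only [id]; ring)

theorem contDiff_powMap : ContDiff ℝ ∞ (powMap ε j) := by
  have h0 : ContDiff ℝ ∞ fun z : ℂ => ‖z‖ ^ 2 := contDiff_norm_sq ℝ
  unfold powMap satur
  refine ((h0.div (contDiff_const.add (contDiff_const.mul h0)) fun z => ?_).pow j).smul contDiff_id
  positivity

theorem fderiv_powMap (z w : ℂ) :
    fderiv ℝ (powMap ε j) z w = (satur ε (‖z‖ ^ 2) ^ j) • w +
      (2 * (j * satur ε (‖z‖ ^ 2) ^ (j - 1) * (1 / (1 + ε * ‖z‖ ^ 2) ^ 2)) * inner ℝ z w) • z := by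
  have h1 := ((hasDerivAt_satur hε (sq_nonneg ‖z‖)).pow j).comp_hasFDerivAt z
    (hasStrictFDerivAt_norm_sq z).hasFDerivAt
  have h2 := h1.smul (hasFDerivAt_id z)
  have h3 : HasFDerivAt (powMap ε j) _ z := h2
  rw [h3.fderiv]
  simp
  left
  ring

/-- The left side is `s` times the derivative of `satur ε s ^ j`. It is controlled because `s / (1 +
εs)² ≤ s / (1 + εs)`, with no loss in `ε`. -/
theorem radial_coeff_le {s : ℝ} (hs : 0 ≤ s) :
    j * satur ε s ^ (j - 1) * (1 / (1 + ε * s) ^ 2) * s ≤ j * satur ε s ^ j := by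
  rcases j.eq_zero_or_pos with rfl | hj
  · simp
  have h : (1 / (1 + ε * s) ^ 2) * s ≤ satur ε s := by
    unfold satur
    rw [one_div_mul_eq_div]
    refine div_le_div_of_nonneg_left hs (by positivity) ?_
    have : 0 ≤ ε * s := by positivity
    nlinarith
  rw [mul_assoc, mul_assoc]
  refine mul_le_mul_of_nonneg_left ?_ (by positivity)
  calc satur ε s ^ (j - 1) * ((1 / (1 + ε * s) ^ 2) * s)
      ≤ satur ε s ^ (j - 1) * satur ε s :=
        mul_le_mul_of_nonneg_left h (pow_nonneg (satur_nonneg hε hs) _)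
    _ = satur ε s ^ j := by rw [← pow_succ]; congr 1; omega

theorem norm_fderiv_powMap_apply_le (z w : ℂ) :
    ‖fderiv ℝ (powMap ε j) z w‖ ≤ (1 + 2 * j) * satur ε (‖z‖ ^ 2) ^ j * ‖w‖ := by
  have hs := sq_nonneg ‖z‖
  have ht := satur_nonneg hε hs
  have hc : 0 ≤ j * satur ε (‖z‖ ^ 2) ^ (j - 1) * (1 / (1 + ε * ‖z‖ ^ 2) ^ 2) := by positivity
  have hr := radial_coeff_le hε j hs
  rw [fderiv_powMap hε]
  refine (norm_add_le _ _).trans ?_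
  rw [norm_smul, norm_smul, Real.norm_of_nonneg (pow_nonneg ht _), norm_mul,
    Real.norm_of_nonneg (by positivity)]
  have hi : ‖inner ℝ z w‖ ≤ ‖z‖ * ‖w‖ := norm_inner_le_norm z w
  set c := j * satur ε (‖z‖ ^ 2) ^ (j - 1) * (1 / (1 + ε * ‖z‖ ^ 2) ^ 2)
  have : 2 * c * ‖inner ℝ z w‖ * ‖z‖ ≤ 2 * (j * satur ε (‖z‖ ^ 2) ^ j) * ‖w‖ := by
    calc 2 * c * ‖inner ℝ z w‖ * ‖z‖ ≤ 2 * c * (‖z‖ * ‖w‖) * ‖z‖ := by gcongr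
      _ = 2 * (c * ‖z‖ ^ 2) * ‖w‖ := by ring
      _ ≤ _ := by gcongr
  linarith

/-- The radial part of the derivative only adds a nonnegative square, since `satur` is increasing.
Taken at `2 * j`, this lower bound matches the square of the upper bound
`norm_fderiv_powMap_apply_le` at `j`. -/
theorem re_inner_fderiv_powMap_ge (z w : ℂ) :
    satur ε (‖z‖ ^ 2) ^ j * ‖w‖ ^ 2 ≤ (inner ℂ (fderiv ℝ (powMap ε j) z w) w).re := by
  have hs := sq_nonneg ‖z‖
  have ht := satur_nonneg hε hs
  have hc : 0 ≤ j * satur ε (‖z‖ ^ 2) ^ (j - 1) * (1 / (1 + ε * ‖z‖ ^ 2) ^ 2) := by positivity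
  rw [fderiv_powMap hε]
  set c := j * satur ε (‖z‖ ^ 2) ^ (j - 1) * (1 / (1 + ε * ‖z‖ ^ 2) ^ 2)
  have h1 : ∀ (a : ℝ) (x : ℂ), (inner ℂ (a • x) w).re = a * inner ℝ x w := fun a x => by
    simp [Complex.inner]
    ring
  rw [inner_add_left, Complex.add_re, h1, h1, real_inner_self_eq_norm_sq]
  have : 0 ≤ 2 * c * inner ℝ z w * inner ℝ z w := by
    have := mul_nonneg hc (mul_self_nonneg (inner ℝ z w))
    linarith
  linarith

theorem norm_powMap_le (z : ℂ) : ‖powMap ε j z‖ ≤ ‖z‖ ^ (2 * j + 1) := by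
  have hs := sq_nonneg ‖z‖
  rw [powMap, norm_smul, Real.norm_of_nonneg (pow_nonneg (satur_nonneg hε hs) _),
    pow_succ ‖z‖ (2 * j), pow_mul]
  gcongr
  · exact satur_nonneg hε hs
  · exact satur_le_self hε hs

theorem norm_fderiv_powMap_le (z : ℂ) :
    ‖fderiv ℝ (powMap ε j) z‖ ≤ ((1 + 2 * j) * (ε⁻¹ ^ j)).toNNReal := by
  rw [Real.coe_toNNReal _ (by positivity)]
  refine ContinuousLinearMap.opNorm_le_bound _ (by positivity) fun w =>
    (norm_fderiv_powMap_apply_le hε j z w).trans ?_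
  gcongr
  · exact satur_nonneg hε (sq_nonneg _)
  · exact satur_le_inv hε (sq_nonneg _)

theorem lipschitzWith_powMap :
    LipschitzWith ((1 + 2 * j) * (ε⁻¹ ^ j)).toNNReal (powMap ε j) :=
  lipschitzWith_of_nnnorm_fderiv_le ((contDiff_powMap hε j).differentiable (by simp))
    fun z => norm_fderiv_powMap_le hε j z

omit hε in
theorem powMap_zero : powMap ε j 0 = 0 := by simp [powMap]

omit hε in
theorem tendsto_powMap (z : ℂ) :
    Tendsto (fun n : ℕ => powMap (1 / ((n : ℝ) + 1)) j z) atTop (𝓝 ((‖z‖ ^ 2) ^ j • z)) := by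
  have h0 := tendsto_one_div_add_atTop_nhds_zero_nat (𝕜 := ℝ)
  have h1 : Tendsto (fun n : ℕ => ‖z‖ ^ 2 / (1 + 1 / ((n : ℝ) + 1) * ‖z‖ ^ 2)) atTop
      (𝓝 (‖z‖ ^ 2)) := by
    have := (tendsto_const_nhds (x := ‖z‖ ^ 2) (f := atTop (α := ℕ))).div
      ((h0.mul_const (‖z‖ ^ 2)).const_add 1) (by simp)
    simpa [Pi.div_def] using this
  exact (h1.pow j).smul_const z

end PowMap

/-! ### Moser iteration -/

section Moser

theorem enorm_sq_lintegral {α : Type*} [MeasurableSpace α] {ν : Measure α} (f : Lp ℂ 2 ν) :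
    ∫⁻ x, ‖f x‖ₑ ^ 2 ∂ν = ‖f‖ₑ ^ 2 := by
  rw [Lp.enorm_def, eLpNorm_eq_lintegral_rpow_enorm_toReal (by simp) (by simp)]
  simp only [ENNReal.toReal_ofNat, ← ENNReal.rpow_natCast, ← ENNReal.rpow_mul]
  norm_num

theorem pow_mul_le_add_pow (a b : ℝ≥0∞) (m : ℕ) : a ^ m * b ≤ a ^ (m + 1) + b ^ (m + 1) := by
  rcases le_total a b with h | h
  · exact (mul_le_mul_left (pow_le_pow_left' h m) b).trans (by rw [← pow_succ]; exact le_add_self)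
  · exact (mul_le_mul_right h (a ^ m)).trans (by rw [← pow_succ]; exact le_self_add)

variable {Ω : Set E3} {u f : L2 Ω}

/-- The energy estimate behind Moser's iteration: test `-Δu = f` with a truncation of
`|u|^{4k} u`. -/
theorem lintegral_powMap_six_le {ε : ℝ} (hε : 0 < ε) (k : ℕ)
    (h : IsNegDirichletLaplacian Ω u f) :
    ∫⁻ x in Ω, ‖powMap ε k (u x)‖ₑ ^ 6 ≤
      (3 * sobolevConst ^ 2 * (1 + 2 * k) ^ 2 *
        ∫⁻ x in Ω, (‖u x‖ₑ ^ (4 * k + 2) + ‖f x‖ₑ ^ (4 * k + 2))) ^ 3 := by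
  obtain ⟨g, hg, hw⟩ := h
  have hS := comp_mem_h10Graph (contDiff_powMap hε k) (norm_fderiv_powMap_le hε k)
    (lipschitzWith_powMap hε k) (powMap_zero k) hg
  have hT := comp_mem_h10Graph (contDiff_powMap hε (2 * k)) (norm_fderiv_powMap_le hε (2 * k))
    (lipschitzWith_powMap hε (2 * k)) (powMap_zero (2 * k)) hg
  have e := hw _ hT
  set a := fun i => fderivComp (contDiff_powMap hε k) (norm_fderiv_powMap_le hε k) u (g i) with ha
  set b := fun i => fderivComp (contDiff_powMap hε (2 * k)) (norm_fderiv_powMap_le hε (2 * k)) u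
    (g i) with hb
  set w := (lipschitzWith_powMap hε (2 * k)).compLp (powMap_zero (2 * k)) u with hw'
  have hsob := eLpNorm_six_le_of_mem_h10Graph hS
  -- The exponent `2k` of the test function is chosen here: the squared gradient of the `k`-th
  -- truncated power is dominated pointwise by the energy density of the `2k`-th against `∇u`.
  have h1 : ∀ i, ‖a i‖ ^ 2 ≤ (1 + 2 * k) ^ 2 * (inner ℂ (b i) (g i)).re := fun i => by
    have i1 : ‖a i‖ ^ 2 = ∫ x in Ω, ‖a i x‖ ^ 2 := by
      rw [← inner_self_eq_norm_sq (𝕜 := ℂ), L2.inner_def, ← integral_re (L2.integrable_inner _ _)]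
      simp [inner_self_eq_norm_sq_to_K, ← Complex.ofReal_pow]
    have i2 : (inner ℂ (b i) (g i)).re = ∫ x in Ω, (inner ℂ (b i x) (g i x)).re := by
      rw [L2.inner_def]
      exact (integral_re (𝕜 := ℂ) (L2.integrable_inner _ _)).symm
    rw [i1, i2, ← integral_const_mul]
    refine integral_mono_ae ?_ ?_ ?_
    · exact (memLp_two_iff_integrable_sq_norm (Lp.aestronglyMeasurable _)).1 (Lp.memLp (a i))
    · exact (L2.integrable_inner (𝕜 := ℂ) (b i) (g i)).re.const_mul _
    · filter_upwards [coeFn_fderivComp (contDiff_powMap hε k) (norm_fderiv_powMap_le hε k) u (g i),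
        coeFn_fderivComp (contDiff_powMap hε (2 * k)) (norm_fderiv_powMap_le hε (2 * k)) u (g i)]
        with x hx hx'
      simp only [ha, hb, hx, hx']
      have j1 := norm_fderiv_powMap_apply_le hε k (u x) (g i x)
      have j2 := re_inner_fderiv_powMap_ge hε (2 * k) (u x) (g i x)
      calc _ ≤ ((1 + 2 * k) * satur ε (‖u x‖ ^ 2) ^ k * ‖g i x‖) ^ 2 := by gcongr
        _ = (1 + 2 * k) ^ 2 * (satur ε (‖u x‖ ^ 2) ^ (2 * k) * ‖g i x‖ ^ 2) := by ring
        _ ≤ _ := by gcongr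
  have h2 : (∑ i, ‖a i‖) ^ 2 ≤ 3 * (1 + 2 * k) ^ 2 * ‖inner ℂ w f‖ := by
    calc (∑ i, ‖a i‖) ^ 2 ≤ 3 * ∑ i, ‖a i‖ ^ 2 := by
          simpa using sq_sum_le_card_mul_sum_sq (s := Finset.univ) (f := fun i : Fin 3 => ‖a i‖)
      _ ≤ 3 * ∑ i, (1 + 2 * k) ^ 2 * (inner ℂ (b i) (g i)).re := by gcongr with i; exact h1 i
      _ = 3 * (1 + 2 * k) ^ 2 * (inner ℂ w f).re := by
          rw [← Finset.mul_sum, ← Complex.re_sum, e]; ring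
      _ ≤ _ := by gcongr; exact Complex.re_le_norm _
  -- The truncation is below `|u|^{4k+1}`, and `|u|^{4k+1}|f|` is at most the sum of the two powers;
  -- the bound no longer involves `ε`.
  have h3 : ‖inner ℂ w f‖ₑ ≤ ∫⁻ x in Ω, (‖u x‖ₑ ^ (4 * k + 2) + ‖f x‖ₑ ^ (4 * k + 2)) := by
    rw [L2.inner_def]
    refine (enorm_integral_le_lintegral_enorm _).trans (lintegral_mono_ae ?_)
    filter_upwards [(lipschitzWith_powMap hε (2 * k)).coeFn_compLp (powMap_zero (2 * k)) u]
      with x hx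
    rw [hw', hx, Function.comp_apply]
    refine le_trans ?_ (pow_mul_le_add_pow ‖u x‖ₑ ‖f x‖ₑ (4 * k + 1))
    rw [← ofReal_norm, ← ofReal_norm, ← ofReal_norm, ← ENNReal.ofReal_pow (norm_nonneg _),
      ← ENNReal.ofReal_mul (by positivity)]
    refine ENNReal.ofReal_le_ofReal ((norm_inner_le_norm _ _).trans ?_)
    gcongr
    refine (norm_powMap_le hε (2 * k) (u x)).trans_eq ?_
    congr 1; ring
  have h4 : (∑ i, ‖a i‖ₑ) ^ 2 ≤ 3 * (1 + 2 * k) ^ 2 *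
      ∫⁻ x in Ω, (‖u x‖ₑ ^ (4 * k + 2) + ‖f x‖ₑ ^ (4 * k + 2)) := by
    refine le_trans ?_ (mul_le_mul_right h3 _)
    have := ENNReal.ofReal_le_ofReal h2
    rw [ENNReal.ofReal_pow (by positivity), ENNReal.ofReal_sum_of_nonneg (by simp),
      ENNReal.ofReal_mul (by positivity), ENNReal.ofReal_mul (by positivity),
      ENNReal.ofReal_pow (by positivity), ENNReal.ofReal_add (by simp) (by positivity),
      ENNReal.ofReal_mul (by simp)] at this
    simpa only [ofReal_norm, ENNReal.ofReal_ofNat, ENNReal.ofReal_one, ENNReal.ofReal_natCast]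
      using this
  have h5 : ∫⁻ x in Ω, ‖powMap ε k (u x)‖ₑ ^ 6 = eLpNorm
      ((lipschitzWith_powMap hε k).compLp (powMap_zero k) u) 6 (volume.restrict Ω) ^ 6 := by
    rw [eLpNorm_congr_ae ((lipschitzWith_powMap hε k).coeFn_compLp (powMap_zero k) u),
      eLpNorm_eq_lintegral_rpow_enorm_toReal (by simp) (by simp)]
    simp only [ENNReal.toReal_ofNat, ← ENNReal.rpow_natCast, ← ENNReal.rpow_mul]
    norm_num
  rw [h5]
  calc _ ≤ (sobolevConst * ∑ i, ‖a i‖ₑ) ^ 6 := by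
        gcongr
        simpa only [Lp.enorm_def] using hsob
    _ = (sobolevConst ^ 2 * (∑ i, ‖a i‖ₑ) ^ 2) ^ 3 := by ring
    _ ≤ (sobolevConst ^ 2 * (3 * (1 + 2 * k) ^ 2 *
      ∫⁻ x in Ω, (‖u x‖ₑ ^ (4 * k + 2) + ‖f x‖ₑ ^ (4 * k + 2)))) ^ 3 := by gcongr
    _ = _ := by ring

/-- Fatou as `ε = 1/(n+1)` tends to `0` removes the truncation; the exponent is `6(2k+1) = 3(4k+2)`,
a gain of a factor `3`. -/
theorem lintegral_pow_le_of_isNegDirichletLaplacian (k : ℕ)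
    (h : IsNegDirichletLaplacian Ω u f) :
    ∫⁻ x in Ω, ‖u x‖ₑ ^ (3 * (4 * k + 2)) ≤
      (3 * sobolevConst ^ 2 * (1 + 2 * k) ^ 2 *
        ∫⁻ x in Ω, (‖u x‖ₑ ^ (4 * k + 2) + ‖f x‖ₑ ^ (4 * k + 2))) ^ 3 := by
  have hlim : ∀ x, Tendsto (fun n : ℕ => ‖powMap (1 / ((n : ℝ) + 1)) k (u x)‖ₑ ^ 6) atTop
      (𝓝 (‖u x‖ₑ ^ (3 * (4 * k + 2)))) := fun x => by
    have h1 := (ENNReal.continuous_pow 6).tendsto _ |>.comp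
      ((continuous_enorm.tendsto _).comp (tendsto_powMap k (u x)))
    refine h1.trans_eq ?_
    rw [enorm_smul]
    simp only [enorm_pow, enorm_norm]
    congr 1
    ring
  calc _ = ∫⁻ x in Ω, liminf (fun n : ℕ => ‖powMap (1 / ((n : ℝ) + 1)) k (u x)‖ₑ ^ 6) atTop := by
        simp only [(hlim _).liminf_eq]
    _ ≤ liminf (fun n : ℕ => ∫⁻ x in Ω, ‖powMap (1 / ((n : ℝ) + 1)) k (u x)‖ₑ ^ 6) atTop := by
        refine lintegral_liminf_le' fun n => ?_
        exact ((contDiff_powMap (by positivity) k).continuous.comp_aestronglyMeasurable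
          (Lp.aestronglyMeasurable u)).enorm.pow_const _
    _ ≤ liminf (fun _ : ℕ => (3 * (sobolevConst : ℝ≥0∞) ^ 2 * (1 + 2 * k) ^ 2 *
        ∫⁻ x in Ω, (‖u x‖ₑ ^ (4 * k + 2) + ‖f x‖ₑ ^ (4 * k + 2))) ^ 3) atTop :=
        liminf_le_liminf (Eventually.of_forall fun n =>
          lintegral_powMap_six_le (by positivity) k h)
    _ = _ := by simp

/-- Moser's iteration, for the orbit of a function under `-Δ`. The constant does not depend on
the domain. -/
theorem exists_lintegral_pow_le_of_orbit (n : ℕ) : ∃ C : NNReal, ∀ (Ω : Set E3) (B : ℝ≥0∞)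
    (u : ℕ → L2 Ω), (∀ j, IsNegDirichletLaplacian Ω (u j) (u (j + 1))) → (∀ j, ‖u j‖ₑ ≤ B) →
      ∫⁻ x in Ω, ‖u 0 x‖ₑ ^ (2 * 3 ^ n) ≤ C * B ^ (2 * 3 ^ n) := by
  induction n with
  | zero =>
    refine ⟨1, fun Ω B u _ hB => ?_⟩
    simp only [pow_zero, mul_one, ENNReal.coe_one, one_mul, enorm_sq_lintegral]
    exact pow_le_pow_left' (hB 0) 2
  | succ n ih =>
    obtain ⟨C, hC⟩ := ih
    -- The energy estimate accepts the exponents `4k + 2`; `2·3ⁿ` has this form because `3ⁿ` is odd.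
    obtain ⟨k, hk⟩ : Odd (3 ^ n) := Odd.pow (by decide)
    have hk' : 2 * 3 ^ n = 4 * k + 2 := by omega
    have hk'' : 2 * 3 ^ (n + 1) = 3 * (4 * k + 2) := by rw [pow_succ]; omega
    rw [hk'] at hC
    refine ⟨(3 * sobolevConst ^ 2 * (1 + 2 * k) ^ 2 * (2 * C)) ^ 3, fun Ω B u hu hB => ?_⟩
    rw [hk'']
    refine (lintegral_pow_le_of_isNegDirichletLaplacian k (hu 0)).trans ?_
    have h0 := hC Ω B u hu hB
    -- The right-hand side `u 1` starts the shifted orbit, so the induction hypothesis bounds it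
    -- too.
    have h1 := hC Ω B (fun j => u (j + 1)) (fun j => hu (j + 1)) (fun j => hB (j + 1))
    rw [lintegral_add_left' ((Lp.aestronglyMeasurable _).enorm.pow_const _)]
    calc _ ≤ (3 * (sobolevConst : ℝ≥0∞) ^ 2 * (1 + 2 * k) ^ 2 *
          (C * B ^ (4 * k + 2) + C * B ^ (4 * k + 2))) ^ 3 := by gcongr
      _ = _ := by push_cast; ring

end Moser

/-! ### Orthogonality and closedness of the eigenspaces -/

section Eigenspace

variable {Ω : Set E3}

theorem inner_eq_zero_of_mem_eigenspace {μ μ' : ℝ} (hne : μ ≠ μ') {u v : L2 Ω}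
    (hu : u ∈ eigenspace Ω μ) (hv : v ∈ eigenspace Ω μ') : inner ℂ u v = 0 := by
  obtain ⟨g, hg, h⟩ := hu
  obtain ⟨g', hg', h'⟩ := hv
  have e1 := h' _ hg
  have e2 := congrArg (starRingEnd ℂ) (h _ hg')
  simp only [map_sum, inner_conj_symm, inner_smul_right, map_mul, Complex.conj_ofReal] at e1 e2
  have e3 : ((μ : ℂ) - μ') * inner ℂ u v = 0 := by rw [sub_mul, ← e1, ← e2, sub_self]
  exact (mul_eq_zero.1 e3).resolve_left (sub_ne_zero.2 (by exact_mod_cast hne))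

theorem eq_zero_of_mem_eigenspace_of_neg {μ : ℝ} (hμ : μ < 0) {u : L2 Ω}
    (hu : u ∈ eigenspace Ω μ) : u = 0 := by
  obtain ⟨g, hg, h⟩ := hu
  have e := congrArg Complex.re (h _ hg)
  simp only [inner_smul_right, Complex.re_sum, Complex.re_ofReal_mul] at e
  have h1 : 0 ≤ ∑ i, (inner ℂ (g i) (g i)).re :=
    Finset.sum_nonneg fun i _ => inner_self_nonneg (𝕜 := ℂ)
  have h2 : (inner ℂ u u).re = ‖u‖ ^ 2 := inner_self_eq_norm_sq (𝕜 := ℂ) u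
  rw [e, h2] at h1
  have : ‖u‖ ^ 2 ≤ 0 := nonpos_of_mul_nonneg_right h1 hμ
  exact norm_eq_zero.1 (by nlinarith [norm_nonneg u])

/-- Testing the equation for a difference against itself bounds the gradients by `√|μ|` times the
`L²` distance, so they converge as well. Closedness lets the projection onto the closed span land in
the eigenspace itself. -/
theorem isClosed_eigenspace (μ : ℝ) : IsClosed (eigenspace Ω μ : Set (L2 Ω)) := by
  refine IsSeqClosed.isClosed fun u u' hu hlim => ?_
  choose g hg h using hu
  have hd : ∀ n m i, ‖g n i - g m i‖ ^ 2 ≤ |μ| * ‖u n - u m‖ ^ 2 := fun n m i => by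
    have hp := (h10Graph Ω).sub_mem (hg n) (hg m)
    have e1 : ∑ i, inner ℂ ((g n - g m) i) ((g n - g m) i) =
        (μ : ℂ) * inner ℂ (u n - u m) (u n - u m) := by
      have a := h n _ hp
      have b := h m _ hp
      simp only [inner_smul_right, Prod.fst_sub, Prod.snd_sub, Pi.sub_apply] at a b ⊢
      simp only [inner_sub_right _ (g n _), Finset.sum_sub_distrib, a, b]
      rw [inner_sub_right _ (u n)]
      ring
    have e2 := congrArg Complex.re e1
    simp only [Complex.re_sum, Complex.re_ofReal_mul] at e2
    have h2 : (inner ℂ (u n - u m) (u n - u m)).re = ‖u n - u m‖ ^ 2 :=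
      inner_self_eq_norm_sq (𝕜 := ℂ) _
    have h3 : ∀ i, (inner ℂ ((g n - g m) i) ((g n - g m) i)).re = ‖g n i - g m i‖ ^ 2 :=
      fun i => inner_self_eq_norm_sq (𝕜 := ℂ) _
    simp only [h2, h3] at e2
    calc _ ≤ ∑ i, ‖g n i - g m i‖ ^ 2 :=
          Finset.single_le_sum (f := fun i => ‖g n i - g m i‖ ^ 2)
            (fun i _ => sq_nonneg _) (Finset.mem_univ i)
      _ ≤ _ := by rw [e2]; gcongr; exact le_abs_self μ
  have hc : ∀ i, CauchySeq fun n => g n i := fun i => by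
    refine Metric.cauchySeq_iff.2 fun ε hε => ?_
    have hpos : 0 < ε / (1 + √|μ|) := by positivity
    obtain ⟨N, hN⟩ := Metric.cauchySeq_iff.1 hlim.cauchySeq _ hpos
    refine ⟨N, fun m hm n hn => ?_⟩
    have h1 := hN m hm n hn
    rw [dist_eq_norm] at h1 ⊢
    have h2 : ‖g m i - g n i‖ ≤ √|μ| * ‖u m - u n‖ := by
      refine abs_le_of_sq_le_sq' ?_ (by positivity) |>.2
      rw [mul_pow, Real.sq_sqrt (abs_nonneg _)]
      exact hd m n i
    have h3 : √|μ| * ‖u m - u n‖ ≤ (1 + √|μ|) * ‖u m - u n‖ := by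
      gcongr; linarith
    rw [lt_div_iff₀ (by positivity)] at h1
    linarith
  choose g' hg' using fun i => cauchySeq_tendsto_of_complete (hc i)
  refine ⟨g', ?_, fun p hp => ?_⟩
  · refine (Submodule.isClosed_topologicalClosure _).mem_of_tendsto
      (hlim.prodMk_nhds (tendsto_pi_nhds.2 hg')) (Eventually.of_forall hg)
  · have a : Tendsto (fun n => ∑ i, inner ℂ (p.2 i) (g n i)) atTop
        (𝓝 (∑ i, inner ℂ (p.2 i) (g' i))) :=
      tendsto_finsetSum _ fun i _ => tendsto_const_nhds.inner (hg' i)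
    have b : Tendsto (fun n => inner ℂ p.1 ((μ : ℂ) • u n)) atTop
        (𝓝 (inner ℂ p.1 ((μ : ℂ) • u'))) :=
      tendsto_const_nhds.inner (hlim.const_smul _)
    simp only [h _ p hp] at a
    exact tendsto_nhds_unique a b

theorem spectralProj_singleton_mem (μ : ℝ) (u : L2 Ω) : spectralProj Ω {μ} u ∈ eigenspace Ω μ := by
  have h : spectralSubspace Ω {μ} = eigenspace Ω μ := by
    unfold spectralSubspace
    rw [iSup_singleton]
    exact (isClosed_eigenspace μ).submodule_topologicalClosure_eq
  rw [← h]
  exact Submodule.starProjection_apply_mem _ _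

theorem orthogonalFamily_eigenspace : OrthogonalFamily ℂ (fun μ => eigenspace Ω μ)
    (fun μ => (eigenspace Ω μ).subtypeₗᵢ) :=
  fun _ _ hne u v => inner_eq_zero_of_mem_eigenspace hne u.2 v.2

theorem enorm_sq_sum_of_mem_eigenspace {F : Finset ℝ} {a : ℝ → L2 Ω}
    (ha : ∀ μ ∈ F, a μ ∈ eigenspace Ω μ) :
    ‖∑ μ ∈ F, a μ‖ₑ ^ 2 = ∑ μ ∈ F, ‖a μ‖ₑ ^ 2 := by
  classical
  have h := orthogonalFamily_eigenspace.norm_sum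
    (fun μ => if h : μ ∈ F then (⟨a μ, ha μ h⟩ : eigenspace Ω μ) else 0) F
  have e1 : ∑ μ ∈ F, (eigenspace Ω μ).subtypeₗᵢ
      (if h : μ ∈ F then (⟨a μ, ha μ h⟩ : eigenspace Ω μ) else 0) = ∑ μ ∈ F, a μ :=
    Finset.sum_congr rfl fun μ hμ => by simp [hμ]
  have e2 : ∑ μ ∈ F, ‖(if h : μ ∈ F then (⟨a μ, ha μ h⟩ : eigenspace Ω μ) else 0)‖ ^ 2 =
      ∑ μ ∈ F, ‖a μ‖ ^ 2 :=
    Finset.sum_congr rfl fun μ hμ => by simp [hμ]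
  rw [e1, e2] at h
  simp only [← ofReal_norm, ← ENNReal.ofReal_pow (norm_nonneg _), h]
  exact ENNReal.ofReal_sum_of_nonneg fun i _ => by positivity

theorem isNegDirichletLaplacian_sum {F : Finset ℝ} {a : ℝ → L2 Ω}
    (ha : ∀ μ ∈ F, a μ ∈ eigenspace Ω μ) :
    IsNegDirichletLaplacian Ω (∑ μ ∈ F, a μ) (∑ μ ∈ F, (μ : ℂ) • a μ) := by
  choose! g hg h using ha
  refine ⟨∑ μ ∈ F, g μ, ?_, fun p hp => ?_⟩
  · have := (h10Graph Ω).sum_mem (t := F) (f := fun μ => (a μ, g μ)) hg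
    convert this using 1
    exact Prod.ext (by simp [Prod.fst_sum]) (by simp [Prod.snd_sum])
  · simp only [Finset.sum_apply, inner_sum]
    rw [Finset.sum_comm]
    exact Finset.sum_congr rfl fun μ hμ => h μ hμ p hp

end Eigenspace

/-! ### `L^q` bounds on spectral clusters -/

section Cluster

/-- Below the level `b` the square term dominates, above it the `p`-th power does. With `b` the `L²`
norm, both terms integrate to multiples of `b ^ q`. -/
theorem rpow_le_interpolation {a b : ℝ≥0∞} {q : ℝ} {p : ℕ} (hq : 2 ≤ q) (hp : q ≤ p)
    (ha : a ≠ ⊤) (hb : b ≠ 0) :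
    a ^ q ≤ b ^ (q - 2) * a ^ 2 + b ^ (q - p) * a ^ p := by
  rcases le_total a b with h | h
  · refine le_trans ?_ le_self_add
    calc a ^ q = a ^ ((q - 2) + 2) := by ring_nf
      _ = a ^ (q - 2) * a ^ (2 : ℝ) := ENNReal.rpow_add_of_nonneg _ _ (by linarith) (by norm_num)
      _ ≤ b ^ (q - 2) * a ^ 2 := by
        rw [ENNReal.rpow_ofNat]
        gcongr
  · refine le_trans ?_ le_add_self
    have ha0 : a ≠ 0 := (hb.bot_lt.trans_le h).ne'
    calc a ^ q = a ^ ((q - p) + p) := by ring_nf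
      _ = a ^ (q - p) * a ^ (p : ℝ) := ENNReal.rpow_add _ _ ha0 ha
      _ ≤ b ^ (q - p) * a ^ p := by
        rw [ENNReal.rpow_natCast]
        gcongr ?_ * _
        rw [← neg_sub, ENNReal.rpow_neg, ENNReal.rpow_neg, ENNReal.inv_le_inv]
        exact ENNReal.rpow_le_rpow h (by linarith)

/-- Low-frequency functions are bounded in every `L^q`, uniformly in the domain. -/
theorem exists_eLpNorm_le_of_low {q : ℝ} (hq : 2 ≤ q) : ∃ C : NNReal, ∀ (Ω : Set E3)
    (F : Finset ℝ) (a : ℝ → L2 Ω), (∀ μ ∈ F, a μ ∈ eigenspace Ω μ) →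
      (∀ μ ∈ F, 0 ≤ μ ∧ μ ≤ 1) →
      eLpNorm (∑ μ ∈ F, a μ : L2 Ω) (ENNReal.ofReal q) (volume.restrict Ω) ≤
        C * ‖∑ μ ∈ F, a μ‖ₑ := by
  obtain ⟨n, hn⟩ : ∃ n : ℕ, q ≤ (2 * 3 ^ n : ℕ) := by
    obtain ⟨n, hn⟩ := exists_nat_ge q
    refine ⟨n, hn.trans ?_⟩
    have : n < 3 ^ n := Nat.lt_pow_self (by norm_num)
    exact_mod_cast (by omega : n ≤ 2 * 3 ^ n)
  obtain ⟨C, hC⟩ := exists_lintegral_pow_le_of_orbit n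
  refine ⟨(1 + C) ^ (1 / q), fun Ω F a ha hF => ?_⟩
  have hq0 : 0 < q := by linarith
  -- The orbit under `-Δ`; eigenvalues in `[0, 1]` keep its `L²` norms below that of `u 0`.
  set u : ℕ → L2 Ω := fun j => ∑ μ ∈ F, ((μ : ℂ) ^ j) • a μ with hu
  have hu0 : u 0 = ∑ μ ∈ F, a μ := by simp [hu]
  rw [← hu0]
  have hmem : ∀ j, ∀ μ ∈ F, ((μ : ℂ) ^ j) • a μ ∈ eigenspace Ω μ := fun j μ hμ =>
    (eigenspace Ω μ).smul_mem _ (ha μ hμ)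
  have h1 : ∀ j, IsNegDirichletLaplacian Ω (u j) (u (j + 1)) := fun j => by
    have := isNegDirichletLaplacian_sum (hmem j)
    simpa only [hu, smul_smul, ← pow_succ'] using this
  have h2 : ∀ j, ‖u j‖ₑ ≤ ‖u 0‖ₑ := fun j => by
    rw [← ENNReal.pow_le_pow_left_iff two_ne_zero, enorm_sq_sum_of_mem_eigenspace (hmem j),
      enorm_sq_sum_of_mem_eigenspace (hmem 0)]
    refine Finset.sum_le_sum fun μ hμ => ?_
    gcongr 1
    rw [enorm_le_iff_norm_le, norm_smul, norm_smul]
    gcongr ?_ * _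
    rw [norm_pow, pow_zero, norm_one, Complex.norm_real, Real.norm_of_nonneg (hF μ hμ).1]
    exact pow_le_one₀ (hF μ hμ).1 (hF μ hμ).2
  have h3 := hC Ω _ u h1 h2
  set b := ‖u 0‖ₑ with hb
  rcases eq_or_ne b 0 with hb0 | hb0
  · have : u 0 = 0 := enorm_eq_zero.1 hb0
    rw [this, eLpNorm_congr_ae (Lp.coeFn_zero ..)]
    simp
  have hbt : b ≠ ⊤ := enorm_ne_top
  set p := 2 * 3 ^ n
  have h4 : ∫⁻ x in Ω, ‖u 0 x‖ₑ ^ q ≤ (1 + C) * b ^ q := by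
    calc ∫⁻ x in Ω, ‖u 0 x‖ₑ ^ q
        ≤ ∫⁻ x in Ω, (b ^ (q - 2) * ‖u 0 x‖ₑ ^ 2 + b ^ (q - p) * ‖u 0 x‖ₑ ^ p) :=
          lintegral_mono fun x => rpow_le_interpolation hq hn enorm_ne_top hb0
      _ = b ^ (q - 2) * b ^ 2 + b ^ (q - p) * ∫⁻ x in Ω, ‖u 0 x‖ₑ ^ p := by
          have hm := (Lp.aestronglyMeasurable (u 0)).enorm
          rw [lintegral_add_left' ((hm.pow_const _).const_mul _),
            lintegral_const_mul'' _ (hm.pow_const _), lintegral_const_mul'' _ (hm.pow_const _),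
            enorm_sq_lintegral]
      _ ≤ b ^ (q - 2) * b ^ 2 + b ^ (q - p) * (C * b ^ p) := by gcongr
      _ = b ^ (q - 2) * b ^ (2 : ℝ) + C * (b ^ (q - p) * b ^ (p : ℝ)) := by
          rw [ENNReal.rpow_natCast, ENNReal.rpow_ofNat]; ring
      _ = _ := by
          rw [← ENNReal.rpow_add _ _ hb0 hbt, ← ENNReal.rpow_add _ _ hb0 hbt]
          ring_nf
  rw [eLpNorm_eq_lintegral_rpow_enorm_toReal (by simpa using hq0) (by simp),
    ENNReal.toReal_ofReal hq0.le]
  calc _ ≤ ((1 + C) * b ^ q) ^ (1 / q) := by gcongr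
    _ = _ := by
      rw [ENNReal.mul_rpow_of_nonneg _ _ (by positivity), ← ENNReal.rpow_mul,
        mul_one_div_cancel hq0.ne', ENNReal.rpow_one, ENNReal.coe_rpow_of_nonneg _ (by positivity)]
      push_cast
      rfl

/-- The spectral cluster estimate `‖𝐏_l u‖_q ≤ M l^δ ‖u‖`. -/
def ClusterBound (Ω : Set E3) (q δ M : ℝ) : Prop :=
  ∀ l : ℝ, 1 ≤ l → ∀ u : L2 Ω,
    eLpNorm (clusterProj Ω l u) (ENNReal.ofReal q) (volume.restrict Ω)
      ≤ ENNReal.ofReal (M * l ^ δ * ‖u‖)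

/-- For `k ≥ 1` the cluster projector fixes the sum and the hypothesis applies; for `k = 0` the
eigenvalues are below `1` and the low-frequency bound takes over. The weight `1 + k` covers both. -/
theorem exists_eLpNorm_cluster_le {q : ℝ} (hq : 2 ≤ q) {δ : ℝ} (hδ : 0 < δ) (M : ℝ) :
    ∃ C : NNReal, ∀ (Ω : Set E3), ClusterBound Ω q δ M →
      ∀ (k : ℕ) (F : Finset ℝ) (a : ℝ → L2 Ω), (∀ μ ∈ F, a μ ∈ eigenspace Ω μ) →
      (∀ μ ∈ F, 0 ≤ μ ∧ ⌊√μ⌋₊ = k) →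
      eLpNorm (∑ μ ∈ F, a μ : L2 Ω) (ENNReal.ofReal q) (volume.restrict Ω) ≤
        C * ENNReal.ofReal ((1 + k : ℝ) ^ δ) * ‖∑ μ ∈ F, a μ‖ₑ := by
  obtain ⟨C, hC⟩ := exists_eLpNorm_le_of_low hq
  refine ⟨C + M.toNNReal, fun Ω hΩ k F a ha hF => ?_⟩
  rcases k.eq_zero_or_pos with rfl | hk
  · refine (hC Ω F a ha fun μ hμ => ⟨(hF μ hμ).1, ?_⟩).trans ?_
    · have := Nat.floor_eq_zero.1 (hF μ hμ).2
      rw [Real.sqrt_lt' one_pos] at this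
      linarith
    · simp only [Nat.cast_zero, add_zero, Real.one_rpow, ENNReal.ofReal_one, mul_one]
      gcongr
      simp
  · have hmem : ∑ μ ∈ F, a μ ∈ spectralSubspace Ω {μ | 0 ≤ μ ∧ √μ ∈ Ico (k : ℝ) (k + 1)} := by
      refine Submodule.le_topologicalClosure _ (Submodule.sum_mem _ fun μ hμ => ?_)
      refine Submodule.mem_iSup_of_mem μ (Submodule.mem_iSup_of_mem ⟨(hF μ hμ).1, ?_⟩ (ha μ hμ))
      exact (Nat.floor_eq_iff (Real.sqrt_nonneg _)).1 (hF μ hμ).2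
    have e : clusterProj Ω k (∑ μ ∈ F, a μ) = ∑ μ ∈ F, a μ :=
      Submodule.starProjection_eq_self_iff.2 hmem
    have h := hΩ k (by exact_mod_cast hk) (∑ μ ∈ F, a μ)
    rw [e] at h
    refine h.trans ?_
    rw [← ofReal_norm, ENNReal.ofReal_mul' (norm_nonneg _), ENNReal.ofReal_mul' (by positivity)]
    gcongr
    · rw [ENNReal.ofReal]
      gcongr
      simp
    · linarith

end Cluster

/-! ### Sobolev embedding on the circle -/

section TrigPoly

/-- The trigonometric polynomial with coefficients `c m`, `m ∈ F`. -/
def trigPoly (F : Finset ℕ) (c : ℕ → ℂ) (t : ℝ) : ℂ :=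
  ∑ m ∈ F, Complex.exp (Complex.I * t * m) * c m

theorem continuous_trigPoly (F : Finset ℕ) (c : ℕ → ℂ) : Continuous (trigPoly F c) := by
  unfold trigPoly
  fun_prop

theorem integral_exp_I_mul_sub (m n : ℕ) :
    ∫ t in (0 : ℝ)..2 * Real.pi, Complex.exp (Complex.I * ((m : ℂ) - n) * t) =
      if m = n then ((2 * Real.pi : ℝ) : ℂ) else 0 := by
  split_ifs with h
  · simp [h]
  · have h0 : (m : ℂ) - n ≠ 0 := sub_ne_zero.2 (by exact_mod_cast h)
    rw [integral_exp_mul_complex (mul_ne_zero Complex.I_ne_zero h0)]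
    have : Complex.exp (Complex.I * ((m : ℂ) - n) * ((2 * Real.pi : ℝ) : ℂ)) = 1 := by
      rw [Complex.exp_eq_one_iff]
      refine ⟨(m : ℤ) - n, ?_⟩
      push_cast
      ring
    rw [this]
    simp

theorem integral_norm_sq_trigPoly (F : Finset ℕ) (c : ℕ → ℂ) :
    ∫ t in (0 : ℝ)..2 * Real.pi, ‖trigPoly F c t‖ ^ 2 = 2 * Real.pi * ∑ m ∈ F, ‖c m‖ ^ 2 := by
  have h : ∀ t : ℝ, ((‖trigPoly F c t‖ ^ 2 : ℝ) : ℂ) = ∑ m ∈ F, ∑ n ∈ F,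
      Complex.exp (Complex.I * ((m : ℂ) - n) * t) * (c m * starRingEnd ℂ (c n)) := fun t => by
    rw [Complex.ofReal_pow, ← Complex.mul_conj', trigPoly, map_sum, Finset.sum_mul_sum]
    refine Finset.sum_congr rfl fun m _ => Finset.sum_congr rfl fun n _ => ?_
    rw [map_mul, ← Complex.exp_conj, mul_mul_mul_comm, ← Complex.exp_add]
    congr 2
    simp
    ring
  have h2 : ((∫ t in (0 : ℝ)..2 * Real.pi, ‖trigPoly F c t‖ ^ 2 : ℝ) : ℂ) =
      ((2 * Real.pi * ∑ m ∈ F, ‖c m‖ ^ 2 : ℝ) : ℂ) := by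
    rw [← intervalIntegral.integral_ofReal]
    simp only [h]
    rw [intervalIntegral.integral_finsetSum fun m _ => Continuous.intervalIntegrable
      (by fun_prop) _ _, Complex.ofReal_mul, Complex.ofReal_sum, Finset.mul_sum]
    refine Finset.sum_congr rfl fun m hm => ?_
    rw [intervalIntegral.integral_finsetSum fun m _ => Continuous.intervalIntegrable
      (by fun_prop) _ _]
    simp only [intervalIntegral.integral_mul_const, integral_exp_I_mul_sub, ite_mul, zero_mul]
    rw [Finset.sum_ite_eq, if_pos hm, Complex.mul_conj', Complex.ofReal_pow]
  exact_mod_cast h2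

theorem lintegral_enorm_sq_trigPoly (F : Finset ℕ) (c : ℕ → ℂ) :
    ∫⁻ t in Icc (0 : ℝ) (2 * Real.pi), ‖trigPoly F c t‖ₑ ^ 2 =
      ENNReal.ofReal (2 * Real.pi * ∑ m ∈ F, ‖c m‖ ^ 2) := by
  rw [← integral_norm_sq_trigPoly, intervalIntegral.integral_of_le (by positivity),
    ← integral_Icc_eq_integral_Ioc, ofReal_integral_eq_lintegral_ofReal]
  · simp only [ENNReal.ofReal_pow (norm_nonneg _), ofReal_norm]
  · exact ((continuous_trigPoly F c).norm.pow 2).integrableOn_Icc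
  · exact ae_of_all _ fun t => by positivity

/-- Discrete form of `∫ x^{σ-1} = x^σ/σ`: Bernoulli's inequality for the concave power bounds each
term by a telescoping difference. -/
theorem sum_range_rpow_le {σ : ℝ} (h0 : 0 < σ) (h1 : σ ≤ 1) (N : ℕ) :
    ∑ m ∈ Finset.range N, (1 + m : ℝ) ^ (σ - 1) ≤ σ⁻¹ * (N : ℝ) ^ σ := by
  induction N with
  | zero => simp; positivity
  | succ n ih =>
    rw [Finset.sum_range_succ]
    have hp : (0 : ℝ) < 1 + n := by positivity
    have hb := rpow_one_add_le_one_add_mul_self (s := -(1 + n : ℝ)⁻¹)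
      (by rw [neg_le_neg_iff]; exact inv_le_one_of_one_le₀ (by linarith [n.cast_nonneg (α := ℝ)]))
      h0.le h1
    have e : (n : ℝ) = (1 + n) * (1 + -(1 + n : ℝ)⁻¹) := by field_simp; ring
    have hle : (n : ℝ) ^ σ ≤ (1 + n : ℝ) ^ σ - σ * (1 + n : ℝ) ^ (σ - 1) := by
      have hnn : (0 : ℝ) ≤ 1 + -(1 + n : ℝ)⁻¹ := by
        have := inv_le_one_of_one_le₀ (by linarith [n.cast_nonneg (α := ℝ)] : (1 : ℝ) ≤ 1 + n)
        linarith
      calc (n : ℝ) ^ σ = (1 + n : ℝ) ^ σ * (1 + -(1 + n : ℝ)⁻¹) ^ σ := by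
            conv_lhs => rw [e]
            exact Real.mul_rpow hp.le hnn
        _ ≤ (1 + n : ℝ) ^ σ * (1 + σ * -(1 + n : ℝ)⁻¹) := by gcongr
        _ = _ := by rw [Real.rpow_sub_one hp.ne']; field_simp; ring
    have h3 : (1 + n : ℝ) ^ (σ - 1) ≤ σ⁻¹ * ((1 + n : ℝ) ^ σ - (n : ℝ) ^ σ) := by
      rw [le_inv_mul_iff₀ h0]; linarith
    push_cast
    rw [add_comm (n : ℝ) 1]
    linarith

/-- The low frequencies of a trigonometric polynomial are bounded pointwise. -/
theorem norm_trigPoly_low_le {σ : ℝ} (h0 : 0 < σ) (h1 : σ ≤ 1) (F : Finset ℕ) (c : ℕ → ℂ)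
    {A : ℝ} (hA : 0 ≤ A) (t : ℝ) :
    ‖trigPoly (F.filter fun m : ℕ => (m : ℝ) + 1 ≤ A) c t‖ ≤
      √(σ⁻¹ * A ^ σ) * √(∑ m ∈ F, (1 + m : ℝ) ^ (1 - σ) * ‖c m‖ ^ 2) := by
  set G := F.filter fun m : ℕ => (m : ℝ) + 1 ≤ A
  have hs : ∑ m ∈ G, (1 + m : ℝ) ^ (σ - 1) ≤ σ⁻¹ * A ^ σ := by
    calc _ ≤ ∑ m ∈ Finset.range ⌊A⌋₊, (1 + m : ℝ) ^ (σ - 1) := by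
          refine Finset.sum_le_sum_of_subset_of_nonneg (fun m hm => ?_) fun m _ _ => by positivity
          rw [Finset.mem_range, Nat.lt_iff_add_one_le]
          exact Nat.le_floor (by exact_mod_cast (Finset.mem_filter.1 hm).2)
      _ ≤ σ⁻¹ * (⌊A⌋₊ : ℝ) ^ σ := sum_range_rpow_le h0 h1 _
      _ ≤ _ := by gcongr; exact Nat.floor_le hA
  calc ‖trigPoly G c t‖ ≤ ∑ m ∈ G, ‖c m‖ := by
        refine (norm_sum_le _ _).trans_eq (Finset.sum_congr rfl fun m _ => ?_)
        rw [norm_mul, Complex.norm_exp]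
        simp
    -- Insert the Sobolev weight and its inverse for Cauchy–Schwarz.
    _ = ∑ m ∈ G, (1 + m : ℝ) ^ ((σ - 1) / 2) * ((1 + m : ℝ) ^ ((1 - σ) / 2) * ‖c m‖) := by
        refine Finset.sum_congr rfl fun m _ => ?_
        rw [← mul_assoc, ← Real.rpow_add (by positivity)]
        ring_nf
        simp
    _ ≤ √(∑ m ∈ G, ((1 + m : ℝ) ^ ((σ - 1) / 2)) ^ 2) *
          √(∑ m ∈ G, ((1 + m : ℝ) ^ ((1 - σ) / 2) * ‖c m‖) ^ 2) :=
        Real.sum_mul_le_sqrt_mul_sqrt _ _ _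
    _ ≤ _ := by
        have e : ∀ (m : ℕ) (x : ℝ), ((1 + m : ℝ) ^ (x / 2)) ^ 2 = (1 + m : ℝ) ^ x := fun m x => by
          rw [← Real.rpow_natCast, ← Real.rpow_mul (by positivity)]
          norm_num
        simp only [mul_pow, e]
        gcongr
        exact Finset.filter_subset _ _

theorem setLIntegral_Ioo_rpow {r Λ : ℝ} (hr : -1 < r) (hΛ : 0 ≤ Λ) :
    ∫⁻ l in Ioo 0 Λ, ENNReal.ofReal (l ^ r) = ENNReal.ofReal (Λ ^ (r + 1) / (r + 1)) := by
  rw [← ofReal_integral_eq_lintegral_ofReal]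
  · rw [← integral_Ioc_eq_integral_Ioo, ← intervalIntegral.integral_of_le hΛ,
      integral_rpow (Or.inl hr), Real.zero_rpow (by linarith), sub_zero]
  · exact ((intervalIntegral.intervalIntegrable_rpow' hr).1).mono_set Ioo_subset_Ioc_self
  · filter_upwards [ae_restrict_mem measurableSet_Ioo] with l hl
    exact Real.rpow_nonneg hl.1.le _

/-- The Sobolev embedding `H^{1/2-1/q} ⊂ L^q` on the circle, for trigonometric polynomials. -/
theorem exists_lintegral_trigPoly_le {q : ℝ} (hq : 2 ≤ q) : ∃ C : NNReal, ∀ (F : Finset ℕ)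
    (c : ℕ → ℂ), ∫⁻ t in Icc (0 : ℝ) (2 * Real.pi), ‖trigPoly F c t‖ₑ ^ q ≤
      C * ENNReal.ofReal (∑ m ∈ F, (1 + m : ℝ) ^ (1 - 2 / q) * ‖c m‖ ^ 2) ^ (q / 2) := by
  -- At `q = 2` the claim is Parseval; the layer-cake argument below divides by `q - 2`.
  rcases hq.eq_or_lt with rfl | hq2
  · refine ⟨(2 * Real.pi).toNNReal, fun F c => ?_⟩
    have h := lintegral_enorm_sq_trigPoly F c
    rw [ENNReal.ofReal_mul (by positivity)] at h
    simp only [ENNReal.rpow_ofNat, h, div_self (two_ne_zero' ℝ), sub_self, Real.rpow_zero, one_mul,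
      ENNReal.rpow_one]
    rfl
  have hq0 : 0 < q := by linarith
  set σ := 2 / q with hσ
  have hσ0 : 0 < σ := by positivity
  have hσ1 : σ ≤ 1 := by rw [hσ, div_le_one hq0]; exact hq
  -- Makes the pointwise bound on the low frequencies at level `l` exactly `l / 2`.
  set κ := 2 * √σ⁻¹ with hκ
  have hκ0 : 0 < κ := by positivity
  refine ⟨(q * (8 * Real.pi * (κ ^ (q - 2) / (q - 2)))).toNNReal, fun F c => ?_⟩
  set W := ∑ m ∈ F, (1 + m : ℝ) ^ (1 - σ) * ‖c m‖ ^ 2 with hW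
  have hW0 : 0 ≤ W := Finset.sum_nonneg fun m _ => by positivity
  rcases hW0.eq_or_lt with hz | hWpos
  · have : ∀ m ∈ F, c m = 0 := fun m hm => by
      have := (Finset.sum_eq_zero_iff_of_nonneg fun m _ => by positivity).1 hz.symm m hm
      have h1 : (1 + m : ℝ) ^ (1 - σ) ≠ 0 := by positivity
      simpa [h1] using this
    have h0 : ∀ t, trigPoly F c t = 0 := fun t =>
      Finset.sum_eq_zero fun m hm => by rw [this m hm, mul_zero]
    simp [h0, hq0]
  have hN : 0 < √W := Real.sqrt_pos.2 hWpos
  -- Frequency `m` is above the cutoff used at level `l` exactly when `l < Λ m`.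
  set Λ : ℕ → ℝ := fun m => κ * √W * (1 + m : ℝ) ^ (1 / q) with hΛ
  have hΛ0 : ∀ m, 0 < Λ m := fun m => by positivity
  have key : ∀ l ∈ Ioi (0 : ℝ), (volume.restrict (Icc (0 : ℝ) (2 * Real.pi)))
      {t | l ≤ ‖trigPoly F c t‖} * ENNReal.ofReal (l ^ (q - 1)) ≤
      ∑ m ∈ F, (Ioo 0 (Λ m)).indicator
        (fun l => ENNReal.ofReal (8 * Real.pi * ‖c m‖ ^ 2) * ENNReal.ofReal (l ^ (q - 3))) l := by
    intro l hl
    rw [mem_Ioi] at hl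
    -- Cutoff depending on the level: the part below `A` never exceeds `l / 2`, so the level set is
    -- governed by the high part, through Chebyshev and Parseval.
    set A := (l / (κ * √W)) ^ q with hA
    have hA0 : 0 ≤ A := by positivity
    set H := F.filter fun m : ℕ => ¬ ((m : ℝ) + 1 ≤ A) with hH
    have hlow : ∀ t, ‖trigPoly (F.filter fun m : ℕ => (m : ℝ) + 1 ≤ A) c t‖ ≤ l / 2 := fun t => by
      refine (norm_trigPoly_low_le hσ0 hσ1 F c hA0 t).trans_eq ?_
      rw [← hW, Real.sqrt_mul (by positivity), hA, ← Real.rpow_mul (by positivity), hσ,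
        mul_div_cancel₀ _ hq0.ne', Real.rpow_ofNat, Real.sqrt_sq (by positivity), ← hσ, hκ]
      field_simp
    have hsub : {t | l ≤ ‖trigPoly F c t‖} ⊆ {t | ENNReal.ofReal (l ^ 2 / 4) ≤
        ‖trigPoly H c t‖ₑ ^ 2} := fun t ht => by
      have hsplit : trigPoly F c t =
          trigPoly (F.filter fun m : ℕ => (m : ℝ) + 1 ≤ A) c t + trigPoly H c t :=
        (Finset.sum_filter_add_sum_filter_not _ _ _).symm
      rw [mem_ofPred_eq] at ht ⊢
      rw [hsplit] at ht
      have h1 : l / 2 ≤ ‖trigPoly H c t‖ := by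
        linarith [norm_add_le (trigPoly (F.filter fun m : ℕ => (m : ℝ) + 1 ≤ A) c t)
          (trigPoly H c t), hlow t]
      rw [← ofReal_norm, ← ENNReal.ofReal_pow (norm_nonneg _)]
      refine ENNReal.ofReal_le_ofReal ?_
      nlinarith
    have hmeas : (volume.restrict (Icc (0 : ℝ) (2 * Real.pi))) {t | l ≤ ‖trigPoly F c t‖} ≤
        ENNReal.ofReal (2 * Real.pi * ∑ m ∈ H, ‖c m‖ ^ 2) / ENNReal.ofReal (l ^ 2 / 4) := by
      refine (measure_mono hsub).trans ?_
      rw [← lintegral_enorm_sq_trigPoly]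
      refine meas_ge_le_lintegral_div ?_ (by simp; positivity) ENNReal.ofReal_ne_top
      exact ((continuous_trigPoly H c).enorm.measurable.pow_const 2).aemeasurable
    rw [← ENNReal.ofReal_div_of_pos (by positivity)] at hmeas
    calc _ ≤ ENNReal.ofReal ((2 * Real.pi * ∑ m ∈ H, ‖c m‖ ^ 2) / (l ^ 2 / 4)) *
          ENNReal.ofReal (l ^ (q - 1)) := by gcongr
      _ = ∑ m ∈ H, ENNReal.ofReal (8 * Real.pi * ‖c m‖ ^ 2) * ENNReal.ofReal (l ^ (q - 3)) := by
        rw [← Finset.sum_mul, ← ENNReal.ofReal_sum_of_nonneg (fun m _ => by positivity),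
          ← ENNReal.ofReal_mul (by positivity),
          ← ENNReal.ofReal_mul (Finset.sum_nonneg fun m _ => by positivity), ← Finset.mul_sum]
        congr 1
        have : l ^ (q - 1) = l ^ (q - 3) * l ^ 2 := by
          rw [← Real.rpow_natCast, ← Real.rpow_add hl]
          congr 1
          push_cast
          ring
        rw [this]
        field_simp
        ring
      _ ≤ _ := by
        rw [hH, Finset.sum_filter]
        refine Finset.sum_le_sum fun m _ => ?_
        split_ifs with hm
        · exact zero_le
        · suffices h : l ∈ Ioo 0 (Λ m) by rw [indicator_of_mem h]
          refine ⟨hl, ?_⟩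
          rw [not_le, hA, add_comm] at hm
          have h1 := Real.rpow_lt_rpow (by positivity) hm (by positivity : 0 < 1 / q)
          rw [← Real.rpow_mul (by positivity), mul_one_div_cancel hq0.ne', Real.rpow_one,
            div_lt_iff₀ (by positivity)] at h1
          rw [hΛ]
          linarith
  have hlayer := lintegral_rpow_eq_lintegral_meas_le_mul
    (volume.restrict (Icc (0 : ℝ) (2 * Real.pi))) (f := fun t => ‖trigPoly F c t‖)
    (ae_of_all _ fun t => norm_nonneg _) (continuous_trigPoly F c).norm.measurable.aemeasurable hq0
  simp only [← ENNReal.ofReal_rpow_of_nonneg (norm_nonneg _) hq0.le, ofReal_norm] at hlayer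
  rw [hlayer]
  -- After exchanging sum and integral, each frequency contributes `∫₀^Λ l^{q-3} dl`, convergent as
  -- `q > 2`; `Λ^{q-2}` produces the weight `(1+m)^{1-2/q}`.
  have hint : ∀ m, ∫⁻ l in Ioi (0 : ℝ), (Ioo 0 (Λ m)).indicator
        (fun l => ENNReal.ofReal (8 * Real.pi * ‖c m‖ ^ 2) * ENNReal.ofReal (l ^ (q - 3))) l =
      ENNReal.ofReal (8 * Real.pi * (κ ^ (q - 2) / (q - 2)) * √W ^ (q - 2) *
        ((1 + m : ℝ) ^ (1 - σ) * ‖c m‖ ^ 2)) := fun m => by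
    rw [setLIntegral_indicator measurableSet_Ioo, inter_eq_self_of_subset_left
      (fun x hx => hx.1), lintegral_const_mul _ (by fun_prop), setLIntegral_Ioo_rpow (by linarith)
      (hΛ0 m).le, ← ENNReal.ofReal_mul (by positivity)]
    congr 1
    have e1 : (Λ m) ^ (q - 3 + 1) = κ ^ (q - 2) * √W ^ (q - 2) * (1 + m : ℝ) ^ (1 - σ) := by
      rw [hΛ, Real.mul_rpow (by positivity) (by positivity), Real.mul_rpow (by positivity)
        (by positivity), ← Real.rpow_mul (by positivity)]
      have e2 : q - 3 + 1 = q - 2 := by ring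
      have e3 : 1 / q * (q - 2) = 1 - σ := by rw [hσ]; field_simp
      rw [e2, e3]
    rw [e1]
    have e2 : q - 3 + 1 = q - 2 := by ring
    rw [e2]
    ring
  have hsum : ∫⁻ l in Ioi (0 : ℝ), (volume.restrict (Icc (0 : ℝ) (2 * Real.pi)))
      {t | l ≤ ‖trigPoly F c t‖} * ENNReal.ofReal (l ^ (q - 1)) ≤
      ENNReal.ofReal (8 * Real.pi * (κ ^ (q - 2) / (q - 2)) * W ^ (q / 2)) := by
    refine (setLIntegral_mono' measurableSet_Ioi key).trans ?_
    rw [lintegral_finsetSum _ fun m _ => Measurable.indicator (by fun_prop) measurableSet_Ioo]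
    simp only [hint]
    have hq2' : 0 < q - 2 := by linarith
    rw [← ENNReal.ofReal_sum_of_nonneg fun m _ => by positivity, ← Finset.mul_sum, ← hW, mul_assoc]
    have e : √W ^ (q - 2) * W = W ^ (q / 2) := by
      rw [Real.sqrt_eq_rpow, ← Real.rpow_mul hW0, ← Real.rpow_add_one hWpos.ne']
      congr 1
      ring
    rw [e]
  refine (mul_le_mul_right hsum _).trans_eq ?_
  have hq2' : 0 < q - 2 := by linarith
  rw [← ENNReal.ofReal_mul hq0.le, ENNReal.ofReal_rpow_of_nonneg hW0 (by positivity), ← mul_assoc,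
    ENNReal.ofReal_mul (by positivity)]
  rfl

end TrigPoly

/-! ### From the circle to space-time -/

section SpaceTime

/-- The circle Sobolev embedding in the time variable, integrated over space. -/
theorem exists_eLpNorm_trigPoly_le {q : ℝ} (hq : 2 ≤ q) : ∃ C : NNReal, ∀ {α : Type}
    [MeasurableSpace α] (ν : Measure α) [SFinite ν] (F : Finset ℕ) (c : ℕ → α → ℂ),
    (∀ m, AEStronglyMeasurable (c m) ν) →
    eLpNorm (fun z : ℝ × α => trigPoly F (fun m => c m z.2) z.1) (ENNReal.ofReal q)
      ((volume.restrict (Icc (0 : ℝ) (2 * Real.pi))).prod ν) ≤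
      C * (∑ m ∈ F, ENNReal.ofReal ((1 + m : ℝ) ^ (1 - 2 / q)) *
        eLpNorm (c m) (ENNReal.ofReal q) ν ^ 2) ^ (1 / 2 : ℝ) := by
  obtain ⟨C, hC⟩ := exists_lintegral_trigPoly_le hq
  have hq0 : 0 < q := by linarith
  refine ⟨C ^ (1 / q), fun {α} _ ν _ F c hc => ?_⟩
  set W : ℕ → α → ℝ := fun m x => (1 + m : ℝ) ^ (1 - 2 / q) * ‖c m x‖ ^ (2 : ℝ) with hW
  have hWm : ∀ m, AEStronglyMeasurable (W m) ν := fun m =>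
    ((hc m).norm.aemeasurable.pow_const _).aestronglyMeasurable.const_mul _
  have hmeas : AEStronglyMeasurable (fun z : ℝ × α => trigPoly F (fun m => c m z.2) z.1)
      ((volume.restrict (Icc (0 : ℝ) (2 * Real.pi))).prod ν) := by
    unfold trigPoly
    refine Finset.aestronglyMeasurable_fun_sum _ fun m _ => ?_
    refine AEStronglyMeasurable.mul ?_ (hc m).comp_snd
    exact (by fun_prop : Continuous fun t : ℝ =>
      Complex.exp (Complex.I * t * m)).aestronglyMeasurable.comp_fst
  have h1 : ∫⁻ z, ‖trigPoly F (fun m => c m z.2) z.1‖ₑ ^ q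
      ∂((volume.restrict (Icc (0 : ℝ) (2 * Real.pi))).prod ν) ≤
      C * eLpNorm (∑ m ∈ F, W m) (ENNReal.ofReal (q / 2)) ν ^ (q / 2) := by
    rw [lintegral_prod_symm _ (hmeas.enorm.pow_const _),
      eLpNorm_eq_lintegral_rpow_enorm_toReal (by simpa using hq0) (by simp),
      ENNReal.toReal_ofReal (by positivity), ← ENNReal.rpow_mul, one_div_mul_cancel (by positivity),
      ENNReal.rpow_one, ← lintegral_const_mul'' _ ?_]
    · refine lintegral_mono fun x => (hC F fun m => c m x).trans_eq ?_
      rw [Finset.sum_apply, Real.enorm_of_nonneg (Finset.sum_nonneg fun m _ => by positivity)]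
      simp only [hW, Real.rpow_ofNat]
    · exact (Finset.aestronglyMeasurable_sum _ fun m _ => hWm m).enorm.pow_const _
  -- Minkowski in `L^{q/2}`, where `q ≥ 2` is needed.
  have h2 : eLpNorm (∑ m ∈ F, W m) (ENNReal.ofReal (q / 2)) ν ≤
      ∑ m ∈ F, ENNReal.ofReal ((1 + m : ℝ) ^ (1 - 2 / q)) *
        eLpNorm (c m) (ENNReal.ofReal q) ν ^ 2 := by
    refine (eLpNorm_sum_le (fun m _ => hWm m) ?_).trans_eq (Finset.sum_congr rfl fun m _ => ?_)
    · rw [← ENNReal.ofReal_one]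
      exact ENNReal.ofReal_le_ofReal (by linarith)
    · have e := eLpNorm_const_smul ((1 + m : ℝ) ^ (1 - 2 / q)) (fun x => ‖c m x‖ ^ (2 : ℝ))
        (ENNReal.ofReal (q / 2)) ν
      have e2 := eLpNorm_norm_rpow (p := ENNReal.ofReal (q / 2)) (μ := ν) (c m) (two_pos (α := ℝ))
      rw [← ENNReal.ofReal_mul (by positivity), div_mul_cancel₀ _ two_ne_zero] at e2
      rw [e2, Real.enorm_of_nonneg (by positivity), ENNReal.rpow_ofNat] at e
      exact e
  rw [eLpNorm_eq_lintegral_rpow_enorm_toReal (by simpa using hq0) (by simp),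
    ENNReal.toReal_ofReal hq0.le]
  calc _ ≤ (C * (∑ m ∈ F, ENNReal.ofReal ((1 + m : ℝ) ^ (1 - 2 / q)) *
        eLpNorm (c m) (ENNReal.ofReal q) ν ^ 2) ^ (q / 2)) ^ (1 / q) := by
        refine ENNReal.rpow_le_rpow (h1.trans ?_) (by positivity)
        gcongr
    _ = _ := by
        rw [ENNReal.mul_rpow_of_nonneg _ _ (by positivity), ← ENNReal.rpow_mul,
          ENNReal.coe_rpow_of_nonneg _ (by positivity)]
        congr 2
        field_simp

end SpaceTime

/-! ### The wave symbol and its integer part -/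

section Symbol

/-- The radicand `μ - (γ²/4) μ^{2α}` of the wave symbol. -/
def waveRadicand (γ α μ : ℝ) : ℝ := μ - γ ^ 2 / 4 * μ ^ (2 * α)

/-- The integer frequency next to the (real part of the) wave symbol. -/
def waveFreq (γ α μ : ℝ) : ℕ := ⌊√(waveRadicand γ α μ)⌋₊

variable {γ α μ : ℝ}

theorem waveRadicand_le (hμ : 0 ≤ μ) : waveRadicand γ α μ ≤ μ :=
  sub_le_self _ (by positivity)

theorem waveFreq_le (hμ : 0 ≤ μ) : waveFreq γ α μ ≤ ⌊√μ⌋₊ :=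
  Nat.floor_le_floor (Real.sqrt_le_sqrt (waveRadicand_le hμ))

theorem exists_threshold (γ : ℝ) (hα : α ∈ Ioo (0 : ℝ) (1 / 2)) : ∃ L : ℝ, 0 < L ∧
    ∀ μ, L ≤ μ → γ ^ 2 / 4 * μ ^ (2 * α - 1) ≤ 1 / 2 := by
  have h := (tendsto_rpow_neg_atTop (y := 1 - 2 * α) (by linarith [hα.2])).const_mul (γ ^ 2 / 4)
  rw [mul_zero] at h
  obtain ⟨L, hL⟩ := eventually_atTop.1 (h.eventually_le_const (by norm_num : (0 : ℝ) < 1 / 2))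
  refine ⟨max L 1, by positivity, fun μ hμ => ?_⟩
  have := hL μ ((le_max_left _ _).trans hμ)
  rwa [neg_sub] at this

theorem half_le_waveRadicand (hμ : 0 < μ) (h : γ ^ 2 / 4 * μ ^ (2 * α - 1) ≤ 1 / 2) :
    μ / 2 ≤ waveRadicand γ α μ := by
  have e : γ ^ 2 / 4 * μ ^ (2 * α) = γ ^ 2 / 4 * μ ^ (2 * α - 1) * μ := by
    rw [Real.rpow_sub_one hμ.ne']
    field_simp
  rw [waveRadicand, e]
  nlinarith

/-- A nonnegative radicand gives a real symbol within `1` of its floor. A negative one occurs only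
below the threshold `L`, where the symbol is bounded and the integer frequency is `0`. -/
theorem exists_norm_waveSymbol_sub_le (γ : ℝ) (hα : α ∈ Ioo (0 : ℝ) (1 / 2)) :
    ∃ R : ℝ, 0 ≤ R ∧ ∀ μ, 0 ≤ μ → ‖waveSymbol γ α μ - waveFreq γ α μ‖ ≤ R := by
  obtain ⟨L, hL0, hL⟩ := exists_threshold γ hα
  refine ⟨1 + √(γ ^ 2 / 4 * L ^ (2 * α)), by positivity, fun μ hμ => ?_⟩
  rcases le_or_gt 0 (waveRadicand γ α μ) with hr | hr
  · have e : waveSymbol γ α μ = (√(waveRadicand γ α μ) : ℝ) := by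
      rw [Real.sqrt_eq_rpow, Complex.ofReal_cpow hr]
      norm_num [waveSymbol, waveRadicand]
    rw [e, waveFreq, ← Complex.ofReal_natCast, ← Complex.ofReal_sub, Complex.norm_real,
      Real.norm_eq_abs, abs_of_nonneg (sub_nonneg.2 (Nat.floor_le (Real.sqrt_nonneg _)))]
    have := Nat.lt_floor_add_one √(waveRadicand γ α μ)
    have := Real.sqrt_nonneg (γ ^ 2 / 4 * L ^ (2 * α))
    linarith
  · have hlt : μ < L := by
      by_contra! h
      have := half_le_waveRadicand (hL0.trans_le h) (hL μ h)
      linarith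
    have e : waveFreq γ α μ = 0 := by simp [waveFreq, Real.sqrt_eq_zero_of_nonpos hr.le]
    have e2 : ‖waveSymbol γ α μ‖ = √|waveRadicand γ α μ| := by
      have h2 : (1 / 2 : ℂ) = ((1 / 2 : ℝ) : ℂ) := by norm_num
      have : waveSymbol γ α μ = ((waveRadicand γ α μ : ℝ) : ℂ) ^ ((1 / 2 : ℝ) : ℂ) := by
        rw [waveSymbol, waveRadicand, h2]
      rw [this, Complex.norm_cpow_real, Complex.norm_real, Real.sqrt_eq_rpow, Real.norm_eq_abs]
    rw [e, Nat.cast_zero, sub_zero, e2]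
    have h3 : √|waveRadicand γ α μ| ≤ √(γ ^ 2 / 4 * L ^ (2 * α)) := by
      refine Real.sqrt_le_sqrt ?_
      rw [abs_of_neg hr, waveRadicand, neg_sub]
      have : μ ^ (2 * α) ≤ L ^ (2 * α) := Real.rpow_le_rpow hμ hlt.le (by linarith [hα.1])
      have := mul_le_mul_of_nonneg_left this (by positivity : 0 ≤ γ ^ 2 / 4)
      linarith
    linarith

/-- Since `x^{2α-1}` decreases, the increment of `x^{2α}` is at most `μ^{2α-1}(μ' - μ)`, which the
threshold makes worth at most half of `μ' - μ`. -/
theorem waveRadicand_sub_ge {μ' : ℝ} (hα : α ∈ Ioo (0 : ℝ) (1 / 2)) (hμ : 0 < μ) (hle : μ ≤ μ')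
    (h : γ ^ 2 / 4 * μ ^ (2 * α - 1) ≤ 1 / 2) :
    (μ' - μ) / 2 ≤ waveRadicand γ α μ' - waveRadicand γ α μ := by
  have hμ' : 0 < μ' := hμ.trans_le hle
  have e : ∀ x : ℝ, 0 < x → x ^ (2 * α) = x ^ (2 * α - 1) * x := fun x hx => by
    rw [Real.rpow_sub_one hx.ne']
    field_simp
  have h1 : μ' ^ (2 * α - 1) ≤ μ ^ (2 * α - 1) :=
    Real.rpow_le_rpow_of_nonpos hμ hle (by linarith [hα.2])
  have h2 : μ' ^ (2 * α) - μ ^ (2 * α) ≤ μ ^ (2 * α - 1) * (μ' - μ) := by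
    rw [e μ' hμ', e μ hμ]
    nlinarith
  have h3 := mul_le_mul_of_nonneg_left h2 (by positivity : 0 ≤ γ ^ 2 / 4)
  have h4 := mul_le_mul_of_nonneg_right h (sub_nonneg.2 hle)
  unfold waveRadicand
  linarith

/-- Equal floors put the roots of the radicands within `1`. Above the threshold, difference of
squares and slope at least `1/2` give `√μ' - √μ ≤ 2`. If `μ` is below it, `√μ'` itself is at most
`2(√L + 1)`. -/
theorem exists_sqrt_le_of_waveFreq_eq (γ : ℝ) (hα : α ∈ Ioo (0 : ℝ) (1 / 2)) :
    ∃ D : ℝ, 0 ≤ D ∧ ∀ μ μ', 0 ≤ μ → 0 ≤ μ' → waveFreq γ α μ = waveFreq γ α μ' →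
      √μ' ≤ √μ + D := by
  obtain ⟨L, hL0, hL⟩ := exists_threshold γ hα
  refine ⟨2 + 2 * (√L + 1), by positivity, fun μ μ' hμ hμ' hf => ?_⟩
  have hsL := Real.sqrt_nonneg L
  have hx := Real.sqrt_nonneg μ
  rcases le_total μ' μ with hle | hle
  · have := Real.sqrt_le_sqrt hle
    linarith
  have hs : √(waveRadicand γ α μ') ≤ √(waveRadicand γ α μ) + 1 := by
    have h1 := Nat.lt_floor_add_one √(waveRadicand γ α μ')
    have h2 := Nat.floor_le (Real.sqrt_nonneg (waveRadicand γ α μ))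
    have h3 : ((⌊√(waveRadicand γ α μ)⌋₊ : ℕ) : ℝ) = ⌊√(waveRadicand γ α μ')⌋₊ := by
      exact_mod_cast hf
    linarith
  have ha := Real.sqrt_le_sqrt (waveRadicand_le (γ := γ) (α := α) hμ)
  have hb := Real.sqrt_le_sqrt (waveRadicand_le (γ := γ) (α := α) hμ')
  rcases le_or_gt L μ with hLμ | hLμ
  · have hμ0 : 0 < μ := hL0.trans_le hLμ
    have hx0 : 0 < √μ := Real.sqrt_pos.2 hμ0
    have h1 := waveRadicand_sub_ge hα hμ0 hle (hL μ hLμ)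
    have h2 := half_le_waveRadicand hμ0 (hL μ hLμ)
    have h3 : 0 ≤ waveRadicand γ α μ := by linarith
    have h4 : waveRadicand γ α μ ≤ waveRadicand γ α μ' := by linarith
    have q1 := Real.sq_sqrt h3
    have q2 := Real.sq_sqrt (h3.trans h4)
    have q3 := Real.sq_sqrt hμ
    have q4 := Real.sq_sqrt hμ'
    have p1 := Real.sqrt_nonneg (waveRadicand γ α μ)
    have p2 := Real.sqrt_nonneg (waveRadicand γ α μ')
    have h5 : √(waveRadicand γ α μ') ^ 2 - √(waveRadicand γ α μ) ^ 2 ≤ √μ + √μ' := by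
      nlinarith
    have h6 : (√μ' - √μ) * (√μ' + √μ) ≤ 2 * (√μ' + √μ) := by nlinarith
    have h7 : √μ' - √μ ≤ 2 := le_of_mul_le_mul_right h6 (by positivity)
    linarith
  · have hLs := Real.sqrt_le_sqrt hLμ.le
    rcases le_or_gt L μ' with h | h
    · have h2 := half_le_waveRadicand (hL0.trans_le h) (hL μ' h)
      have q2 := Real.sq_sqrt (by linarith : 0 ≤ waveRadicand γ α μ')
      have p2 := Real.sqrt_nonneg (waveRadicand γ α μ')
      have : √μ' ≤ 2 * (√L + 1) := by
        rw [Real.sqrt_le_left (by positivity)]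
        nlinarith
      linarith
    · have := Real.sqrt_le_sqrt h.le
      linarith

theorem exists_card_image_floor_sqrt_le (γ : ℝ) (hα : α ∈ Ioo (0 : ℝ) (1 / 2)) :
    ∃ N : ℕ, ∀ (F : Finset ℝ) (m : ℕ), (∀ μ ∈ F, 0 ≤ μ) → (∀ μ ∈ F, waveFreq γ α μ = m) →
      (F.image fun μ => ⌊√μ⌋₊).card ≤ N := by
  obtain ⟨D, hD0, hD⟩ := exists_sqrt_le_of_waveFreq_eq γ hα
  refine ⟨⌊D⌋₊ + 2, fun F m h0 hF => ?_⟩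
  rcases F.eq_empty_or_nonempty with rfl | hne
  · simp
  obtain ⟨μ, hμ, hmin⟩ := F.exists_min_image id hne
  have hsub : F.image (fun μ => ⌊√μ⌋₊) ⊆ Finset.Ico ⌊√μ⌋₊ (⌊√μ⌋₊ + (⌊D⌋₊ + 2)) := by
    intro k hk
    obtain ⟨μ', hμ', rfl⟩ := Finset.mem_image.1 hk
    rw [Finset.mem_Ico]
    refine ⟨Nat.floor_le_floor (Real.sqrt_le_sqrt (hmin μ' hμ')), ?_⟩
    rw [Nat.floor_lt (Real.sqrt_nonneg _)]
    have h1 := hD μ μ' (h0 μ hμ) (h0 μ' hμ') ((hF μ hμ).trans (hF μ' hμ').symm)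
    have h2 := Nat.lt_floor_add_one √μ
    have h3 := Nat.lt_floor_add_one D
    push_cast
    linarith
  exact (Finset.card_le_card hsub).trans_eq (by simp)

end Symbol

/-! ### Space-time estimate for finite spectral sums -/

section FiniteSums

theorem coeFn_sum_ae {α ι : Type*} [MeasurableSpace α] {ν : Measure α} {p : ℝ≥0∞}
    (F : Finset ι) (a : ι → Lp ℂ p ν) : (∑ i ∈ F, a i : Lp ℂ p ν) =ᵐ[ν] fun x => ∑ i ∈ F, a i x := by
  classical
  induction F using Finset.induction_on with
  | empty => simp only [Finset.sum_empty]; exact Lp.coeFn_zero ℂ p ν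
  | insert i F hi ih =>
    rw [Finset.sum_insert hi]
    filter_upwards [Lp.coeFn_add (a i) (∑ i ∈ F, a i), ih] with x h1 h2
    rw [h1, Pi.add_apply, h2, Finset.sum_insert hi]

theorem eLpNorm_coeFn_sum_le {α ι : Type*} [MeasurableSpace α] {ν : Measure α} {p : ℝ≥0∞}
    (hp : 1 ≤ p) (F : Finset ι) (a : ι → Lp ℂ 2 ν) :
    eLpNorm (∑ i ∈ F, a i : Lp ℂ 2 ν) p ν ≤ ∑ i ∈ F, eLpNorm (a i) p ν := by
  have h : (∑ i ∈ F, a i : Lp ℂ 2 ν) =ᵐ[ν] ∑ i ∈ F, (a i : α → ℂ) := by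
    filter_upwards [coeFn_sum_ae F a] with x hx
    rw [hx, Finset.sum_apply]
  rw [eLpNorm_congr_ae h]
  exact eLpNorm_sum_le (fun i _ => Lp.aestronglyMeasurable _) hp

/-- The time frequency never exceeds the cluster index, so both weights are powers of `1 + ⌊√μ⌋₊`
with total exponent `2(δ + 1/2 - 1/q)`, and `(1 + ⌊√μ⌋₊)² ≤ 2(1 + μ)`. -/
theorem weight_le {q δ μ : ℝ} (hq : 2 ≤ q) (hδ : 0 < δ) (hμ : 0 ≤ μ) {m : ℕ} (hm : m ≤ ⌊√μ⌋₊) :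
    (1 + m : ℝ) ^ (1 - 2 / q) * ((1 + (⌊√μ⌋₊ : ℝ)) ^ δ) ^ 2 ≤
      2 ^ (δ + 1 / 2 - 1 / q) * (1 + μ) ^ (δ + 1 / 2 - 1 / q) := by
  set k := ⌊√μ⌋₊
  have hk : (k : ℝ) ≤ √μ := Nat.floor_le (Real.sqrt_nonneg _)
  have hm' : (m : ℝ) ≤ k := by exact_mod_cast hm
  have hk0 : (0 : ℝ) ≤ k := k.cast_nonneg
  have hq' : 2 / q ≤ 1 := (div_le_one (by linarith)).2 hq
  have hs : 0 ≤ δ + 1 / 2 - 1 / q := by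
    have : 1 / q = 2 / q / 2 := by ring
    linarith
  have h2 : (1 + k : ℝ) ^ 2 ≤ 2 * (1 + μ) := by
    have := Real.sq_sqrt hμ
    nlinarith [sq_nonneg (√μ - 1), Real.sqrt_nonneg μ]
  calc (1 + m : ℝ) ^ (1 - 2 / q) * ((1 + (k : ℝ)) ^ δ) ^ 2
      ≤ (1 + k : ℝ) ^ (1 - 2 / q) * ((1 + (k : ℝ)) ^ δ) ^ 2 := by gcongr
    _ = ((1 + k : ℝ) ^ 2) ^ (δ + 1 / 2 - 1 / q) := by
        rw [← Real.rpow_natCast, ← Real.rpow_natCast, ← Real.rpow_mul (by positivity),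
          ← Real.rpow_mul (by positivity), ← Real.rpow_add (by positivity)]
        congr 1
        push_cast
        ring
    _ ≤ (2 * (1 + μ)) ^ (δ + 1 / 2 - 1 / q) := by gcongr
    _ = _ := Real.mul_rpow (by norm_num) (by positivity)

variable {γ α q δ M : ℝ}

/-- All the eigenfunctions whose wave frequency lies near a given integer `m`. -/
theorem exists_eLpNorm_freq_le (γ : ℝ) (hα : α ∈ Ioo (0 : ℝ) (1 / 2)) (hq : 2 ≤ q)
    (hδ : 0 < δ) (M : ℝ) : ∃ C : NNReal, ∀ (Ω : Set E3), ClusterBound Ω q δ M →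
      ∀ (m : ℕ) (F : Finset ℝ) (a : ℝ → L2 Ω), (∀ μ ∈ F, a μ ∈ eigenspace Ω μ) →
      (∀ μ ∈ F, 0 ≤ μ) → (∀ μ ∈ F, waveFreq γ α μ = m) →
      ENNReal.ofReal ((1 + m : ℝ) ^ (1 - 2 / q)) *
        eLpNorm (∑ μ ∈ F, a μ : L2 Ω) (ENNReal.ofReal q) (volume.restrict Ω) ^ 2 ≤
        C * ∑ μ ∈ F, ENNReal.ofReal ((1 + μ) ^ (δ + 1 / 2 - 1 / q)) * ‖a μ‖ₑ ^ 2 := by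
  obtain ⟨C, hC⟩ := exists_eLpNorm_cluster_le hq hδ M
  obtain ⟨N, hN⟩ := exists_card_image_floor_sqrt_le γ hα
  refine ⟨N * C ^ 2 * (2 ^ (δ + 1 / 2 - 1 / q) : ℝ).toNNReal, fun Ω hΩ m F a ha h0 hF => ?_⟩
  have hq1 : 1 ≤ ENNReal.ofReal q := by
    rw [← ENNReal.ofReal_one]
    exact ENNReal.ofReal_le_ofReal (by linarith)
  set K := F.image fun μ => ⌊√μ⌋₊ with hK
  set d : ℕ → L2 Ω := fun k => ∑ μ ∈ F with ⌊√μ⌋₊ = k, a μ with hd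
  have hsum : ∑ μ ∈ F, a μ = ∑ k ∈ K, d k :=
    (Finset.sum_fiberwise_of_maps_to (fun μ hμ => Finset.mem_image_of_mem _ hμ) _).symm
  have hk : ∀ k, eLpNorm (d k) (ENNReal.ofReal q) (volume.restrict Ω) ^ 2 ≤
      C ^ 2 * ENNReal.ofReal (((1 + k : ℝ) ^ δ) ^ 2) *
        ∑ μ ∈ F with ⌊√μ⌋₊ = k, ‖a μ‖ₑ ^ 2 := fun k => by
    have hmem : ∀ μ ∈ F.filter (fun μ => ⌊√μ⌋₊ = k), a μ ∈ eigenspace Ω μ := fun μ hμ =>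
      ha μ (Finset.mem_filter.1 hμ).1
    have h := hC Ω hΩ k _ a hmem fun μ hμ =>
      ⟨h0 μ (Finset.mem_filter.1 hμ).1, (Finset.mem_filter.1 hμ).2⟩
    refine (pow_le_pow_left' h 2).trans_eq ?_
    rw [mul_pow, mul_pow, enorm_sq_sum_of_mem_eigenspace hmem, ENNReal.ofReal_pow (by positivity)]
  -- Cauchy–Schwarz over the clusters costs only their number, bounded independently of `m`.
  have hcs : (∑ k ∈ K, eLpNorm (d k) (ENNReal.ofReal q) (volume.restrict Ω)) ^ 2 ≤
      N * ∑ k ∈ K, eLpNorm (d k) (ENNReal.ofReal q) (volume.restrict Ω) ^ 2 := by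
    have h := ENNReal.rpow_sum_le_const_mul_sum_rpow K
      (fun k => eLpNorm (d k) (ENNReal.ofReal q) (volume.restrict Ω)) (one_le_two (α := ℝ))
    simp only [ENNReal.rpow_ofNat] at h
    refine h.trans ?_
    norm_num
    gcongr
    exact_mod_cast hN F m h0 hF
  calc _ ≤ ENNReal.ofReal ((1 + m : ℝ) ^ (1 - 2 / q)) *
        (N * ∑ k ∈ K, eLpNorm (d k) (ENNReal.ofReal q) (volume.restrict Ω) ^ 2) := by
        rw [hsum]
        gcongr
        exact (pow_le_pow_left' (eLpNorm_coeFn_sum_le hq1 K d) 2).trans hcs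
    _ ≤ ENNReal.ofReal ((1 + m : ℝ) ^ (1 - 2 / q)) *
        (N * ∑ k ∈ K, C ^ 2 * ENNReal.ofReal (((1 + k : ℝ) ^ δ) ^ 2) *
        ∑ μ ∈ F with ⌊√μ⌋₊ = k, ‖a μ‖ₑ ^ 2) := by
        gcongr with k
        exact hk k
    _ = N * C ^ 2 * ∑ k ∈ K, ∑ μ ∈ F with ⌊√μ⌋₊ = k, ENNReal.ofReal
        ((1 + m : ℝ) ^ (1 - 2 / q) * ((1 + (⌊√μ⌋₊ : ℝ)) ^ δ) ^ 2) * ‖a μ‖ₑ ^ 2 := by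
        simp only [Finset.mul_sum]
        refine Finset.sum_congr rfl fun k _ => Finset.sum_congr rfl fun μ hμ => ?_
        rw [(Finset.mem_filter.1 hμ).2, ENNReal.ofReal_mul (by positivity)]
        ring
    _ = N * C ^ 2 * ∑ μ ∈ F, ENNReal.ofReal
        ((1 + m : ℝ) ^ (1 - 2 / q) * ((1 + (⌊√μ⌋₊ : ℝ)) ^ δ) ^ 2) * ‖a μ‖ₑ ^ 2 := by
        rw [Finset.sum_fiberwise_of_maps_to fun μ hμ => Finset.mem_image_of_mem _ hμ]
    _ ≤ N * C ^ 2 * ∑ μ ∈ F, ENNReal.ofReal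
        (2 ^ (δ + 1 / 2 - 1 / q) * (1 + μ) ^ (δ + 1 / 2 - 1 / q)) * ‖a μ‖ₑ ^ 2 := by
        refine mul_le_mul_right (Finset.sum_le_sum fun μ hμ =>
          mul_le_mul_left (ENNReal.ofReal_le_ofReal ?_) _) _
        exact weight_le hq hδ (h0 μ hμ) (hF μ hμ ▸ waveFreq_le (h0 μ hμ))
    _ = _ := by
        simp only [ENNReal.ofReal_mul (by positivity : (0 : ℝ) ≤ 2 ^ (δ + 1 / 2 - 1 / q)),
          mul_assoc, ← Finset.mul_sum]
        push_cast
        simp only [mul_assoc]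
        rfl

/-- The space-time estimate for the flow whose frequencies are rounded to integers. -/
theorem exists_eLpNorm_integer_freq_sum_le (γ : ℝ) (hα : α ∈ Ioo (0 : ℝ) (1 / 2)) (hq : 2 ≤ q)
    (hδ : 0 < δ) (M : ℝ) : ∃ C : NNReal, ∀ (Ω : Set E3), ClusterBound Ω q δ M →
      ∀ (F : Finset ℝ) (a : ℝ → L2 Ω) (β : ℝ → ℂ) (ρ : ℝ), 0 ≤ ρ →
      (∀ μ ∈ F, a μ ∈ eigenspace Ω μ) → (∀ μ ∈ F, 0 ≤ μ) → (∀ μ ∈ F, ‖β μ‖ ≤ ρ) →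
      eLpNorm (fun z : ℝ × E3 =>
          ∑ μ ∈ F, Complex.exp (Complex.I * z.1 * waveFreq γ α μ) * (β μ * a μ z.2))
        (ENNReal.ofReal q)
        ((volume.restrict (Icc (0 : ℝ) (2 * Real.pi))).prod (volume.restrict Ω)) ≤
        C * ENNReal.ofReal ρ *
          (∑ μ ∈ F, ENNReal.ofReal ((1 + μ) ^ (δ + 1 / 2 - 1 / q)) * ‖a μ‖ₑ ^ 2) ^ (1 / 2 : ℝ) := by
  obtain ⟨C, hC⟩ := exists_eLpNorm_trigPoly_le hq
  obtain ⟨C', hC'⟩ := exists_eLpNorm_freq_le γ hα hq hδ M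
  refine ⟨C * C' ^ (1 / 2 : ℝ), fun Ω hΩ F a β ρ hρ ha h0 hβ => ?_⟩
  set K := F.image (waveFreq γ α) with hK
  set c : ℕ → E3 → ℂ := fun m x => ∑ μ ∈ F with waveFreq γ α μ = m, β μ * a μ x with hc
  have hcL : ∀ m, (∑ μ ∈ F with waveFreq γ α μ = m, β μ • a μ : L2 Ω)
      =ᵐ[volume.restrict Ω] c m := fun m => by
    refine (coeFn_sum_ae _ _).trans ?_
    have : ∀ᵐ x ∂(volume.restrict Ω), ∀ μ ∈ F.filter (fun μ => waveFreq γ α μ = m),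
        (β μ • a μ : L2 Ω) x = β μ * a μ x := by
      rw [Finset.eventually_all]
      exact fun μ _ => Lp.coeFn_smul _ _
    filter_upwards [this] with x hx
    exact Finset.sum_congr rfl hx
  have hmaps : ∀ μ ∈ F, waveFreq γ α μ ∈ K := fun μ hμ => Finset.mem_image_of_mem _ hμ
  have e : (fun z : ℝ × E3 =>
      ∑ μ ∈ F, Complex.exp (Complex.I * z.1 * waveFreq γ α μ) * (β μ * a μ z.2)) =
      fun z => trigPoly K (fun m => c m z.2) z.1 := by
    funext z
    rw [trigPoly, ← Finset.sum_fiberwise_of_maps_to hmaps]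
    refine Finset.sum_congr rfl fun m _ => ?_
    rw [hc, Finset.mul_sum]
    exact Finset.sum_congr rfl fun μ hμ => by rw [(Finset.mem_filter.1 hμ).2]
  rw [e]
  have hm : ∀ m : ℕ, ENNReal.ofReal ((1 + m : ℝ) ^ (1 - 2 / q)) *
      eLpNorm (c m) (ENNReal.ofReal q) (volume.restrict Ω) ^ 2 ≤
      C' * ENNReal.ofReal ρ ^ 2 * ∑ μ ∈ F with waveFreq γ α μ = m,
        ENNReal.ofReal ((1 + μ) ^ (δ + 1 / 2 - 1 / q)) * ‖a μ‖ₑ ^ 2 := fun m => by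
    rw [← eLpNorm_congr_ae (hcL m)]
    refine (hC' Ω hΩ m _ _ (fun μ hμ => (eigenspace Ω μ).smul_mem _
      (ha μ (Finset.mem_filter.1 hμ).1)) (fun μ hμ => h0 μ (Finset.mem_filter.1 hμ).1)
      (fun μ hμ => (Finset.mem_filter.1 hμ).2)).trans ?_
    rw [mul_assoc]
    gcongr
    rw [Finset.mul_sum]
    refine Finset.sum_le_sum fun μ hμ => ?_
    rw [enorm_smul, mul_pow, mul_left_comm]
    gcongr
    rw [← ofReal_norm]
    exact ENNReal.ofReal_le_ofReal (hβ μ (Finset.mem_filter.1 hμ).1)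
  refine (hC (volume.restrict Ω) K c fun m =>
    (Lp.aestronglyMeasurable _).congr (hcL m)).trans ?_
  calc _ ≤ C * (∑ m ∈ K, C' * ENNReal.ofReal ρ ^ 2 * ∑ μ ∈ F with waveFreq γ α μ = m,
        ENNReal.ofReal ((1 + μ) ^ (δ + 1 / 2 - 1 / q)) * ‖a μ‖ₑ ^ 2) ^ (1 / 2 : ℝ) := by
        exact mul_le_mul_right (ENNReal.rpow_le_rpow (Finset.sum_le_sum fun m _ => hm m)
          (by norm_num)) _
    _ = C * (C' * ENNReal.ofReal ρ ^ 2 * ∑ μ ∈ F,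
        ENNReal.ofReal ((1 + μ) ^ (δ + 1 / 2 - 1 / q)) * ‖a μ‖ₑ ^ 2) ^ (1 / 2 : ℝ) := by
        rw [← Finset.mul_sum, Finset.sum_fiberwise_of_maps_to hmaps]
    _ = _ := by
        have h2 : (ENNReal.ofReal ρ ^ 2) ^ (1 / 2 : ℝ) = ENNReal.ofReal ρ := by
          rw [← ENNReal.rpow_natCast, ← ENNReal.rpow_mul]
          norm_num
        rw [ENNReal.mul_rpow_of_nonneg _ _ (by norm_num),
          ENNReal.mul_rpow_of_nonneg _ _ (by norm_num), h2, ENNReal.coe_mul,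
          ENNReal.coe_rpow_of_nonneg _ (by norm_num)]
        ring

/-- The finite sum `∑_{μ ∈ F} e^{itω(μ)} a_μ(x)`. -/
def waveSum {Ω : Set E3} (γ α : ℝ) (F : Finset ℝ) (a : ℝ → L2 Ω) (z : ℝ × E3) : ℂ :=
  ∑ μ ∈ F, Complex.exp (Complex.I * z.1 * waveSymbol γ α μ) * a μ z.2

theorem aestronglyMeasurable_exp_mul {Ω : Set E3} (κ : Measure ℝ) (w : ℂ) (u : L2 Ω) :
    AEStronglyMeasurable (fun z : ℝ × E3 => Complex.exp (Complex.I * z.1 * w) * u z.2)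
      (κ.prod (volume.restrict Ω)) :=
  ((by fun_prop : Continuous fun t : ℝ =>
      Complex.exp (Complex.I * t * w)).aestronglyMeasurable.comp_fst).mul
    (Lp.aestronglyMeasurable u).comp_snd

theorem aestronglyMeasurable_waveSum {Ω : Set E3} (κ : Measure ℝ) (γ α : ℝ) (F : Finset ℝ)
    (a : ℝ → L2 Ω) : AEStronglyMeasurable (waveSum γ α F a) (κ.prod (volume.restrict Ω)) :=
  Finset.aestronglyMeasurable_fun_sum _ fun _ _ => aestronglyMeasurable_exp_mul κ _ _

/-- The space-time estimate for finite sums of eigenfunctions. -/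
theorem exists_eLpNorm_waveSum_le (γ : ℝ) (hα : α ∈ Ioo (0 : ℝ) (1 / 2)) (hq : 2 ≤ q)
    (hδ : 0 < δ) (M : ℝ) : ∃ C : NNReal, ∀ (Ω : Set E3), ClusterBound Ω q δ M →
      ∀ (F : Finset ℝ) (a : ℝ → L2 Ω), (∀ μ ∈ F, a μ ∈ eigenspace Ω μ) → (∀ μ ∈ F, 0 ≤ μ) →
      eLpNorm (waveSum γ α F a) (ENNReal.ofReal q)
        ((volume.restrict (Icc (0 : ℝ) (2 * Real.pi))).prod (volume.restrict Ω)) ≤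
        C * (∑ μ ∈ F, ENNReal.ofReal ((1 + μ) ^ (δ + 1 / 2 - 1 / q)) * ‖a μ‖ₑ ^ 2)
          ^ (1 / 2 : ℝ) := by
  obtain ⟨C, hC⟩ := exists_eLpNorm_integer_freq_sum_le γ hα hq hδ M
  obtain ⟨R, hR0, hR⟩ := exists_norm_waveSymbol_sub_le γ hα
  refine ⟨C * (Real.exp (2 * Real.pi * R)).toNNReal, fun Ω hΩ F a ha h0 => ?_⟩
  have hq1 : 1 ≤ ENNReal.ofReal q := by
    rw [← ENNReal.ofReal_one]
    exact ENNReal.ofReal_le_ofReal (by linarith)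
  set P := (volume.restrict (Icc (0 : ℝ) (2 * Real.pi))).prod (volume.restrict Ω)
  set X := (∑ μ ∈ F, ENNReal.ofReal ((1 + μ) ^ (δ + 1 / 2 - 1 / q)) * ‖a μ‖ₑ ^ 2) ^ (1 / 2 : ℝ)
  set S : ℕ → ℝ × E3 → ℂ := fun j z => ∑ μ ∈ F, Complex.exp (Complex.I * z.1 * waveFreq γ α μ) *
    ((waveSymbol γ α μ - waveFreq γ α μ) ^ j * a μ z.2) with hS
  -- The `j`-th Taylor term of `e^{it(ω-m)}` in the flow. The power of `t` is common to all `μ` and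
  -- bounded by `(2π)^j`, while `(ω-m)^j` acts as a multiplier of size at most `R^j`.
  set V : ℕ → ℝ × E3 → ℂ := fun j z => (Complex.I * z.1) ^ j / (Nat.factorial j) * S j z with hV
  have hSm : ∀ j, AEStronglyMeasurable (S j) P := fun j => by
    refine Finset.aestronglyMeasurable_fun_sum _ fun μ _ => ?_
    refine ((aestronglyMeasurable_exp_mul _ (waveFreq γ α μ) (a μ)).const_mul
      ((waveSymbol γ α μ - waveFreq γ α μ) ^ j)).congr (ae_of_all _ fun z => ?_)
    ring
  have hVm : ∀ j, AEStronglyMeasurable (V j) P := fun j =>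
    ((by fun_prop : Continuous fun t : ℝ => (Complex.I * t) ^ j /
      (Nat.factorial j)).aestronglyMeasurable.comp_fst).mul (hSm j)
  have hVle : ∀ j, eLpNorm (V j) (ENNReal.ofReal q) P ≤
      ENNReal.ofReal ((2 * Real.pi * R) ^ j / (Nat.factorial j)) * (C * X) := fun j => by
    have hae : ∀ᵐ z ∂P, ‖V j z‖ ≤ (2 * Real.pi) ^ j / (Nat.factorial j) * ‖S j z‖ := by
      have h1 : ∀ᵐ z ∂P, z.1 ∈ Icc (0 : ℝ) (2 * Real.pi) :=
        Measure.quasiMeasurePreserving_fst.ae (ae_restrict_mem measurableSet_Icc)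
      filter_upwards [h1] with z hz
      rw [hV]
      simp only [norm_mul, norm_div, norm_pow, Complex.norm_I, one_mul, Complex.norm_natCast,
        Complex.norm_real, Real.norm_of_nonneg hz.1]
      gcongr
      · exact hz.1
      · exact hz.2
    refine (eLpNorm_le_mul_eLpNorm_of_ae_le_mul hae _).trans ?_
    calc _ ≤ ENNReal.ofReal ((2 * Real.pi) ^ j / (Nat.factorial j)) *
          (C * ENNReal.ofReal (R ^ j) * X) := by
          gcongr
          refine hC Ω hΩ F a _ (R ^ j) (by positivity) ha h0 fun μ hμ => ?_
          rw [norm_pow]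
          exact pow_le_pow_left₀ (norm_nonneg _) (hR μ (h0 μ hμ)) j
      _ = ENNReal.ofReal ((2 * Real.pi) ^ j / (Nat.factorial j)) * ENNReal.ofReal (R ^ j) *
          (C * X) := by ring
      _ = _ := by
          rw [← ENNReal.ofReal_mul (by positivity)]
          congr 2
          rw [mul_pow]
          ring
  have hlim : ∀ z, Tendsto (fun J : ℕ => (∑ j ∈ Finset.range J, V j) z) atTop
      (𝓝 (waveSum γ α F a z)) := fun z => by
    have h : ∀ J : ℕ, (∑ j ∈ Finset.range J, V j) z = ∑ μ ∈ F,
        (∑ j ∈ Finset.range J, (Complex.I * z.1 * (waveSymbol γ α μ - waveFreq γ α μ)) ^ j /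
          (Nat.factorial j)) * (Complex.exp (Complex.I * z.1 * waveFreq γ α μ) * a μ z.2) := by
      intro J
      rw [Finset.sum_apply]
      simp only [hV, hS, Finset.mul_sum, Finset.sum_mul]
      rw [Finset.sum_comm]
      refine Finset.sum_congr rfl fun μ _ => Finset.sum_congr rfl fun j _ => ?_
      rw [mul_pow (Complex.I * z.1)]
      ring
    simp only [h]
    refine tendsto_finsetSum _ fun μ _ => ?_
    have e : Complex.exp (Complex.I * z.1 * waveSymbol γ α μ) * a μ z.2 =
        Complex.exp (Complex.I * z.1 * (waveSymbol γ α μ - waveFreq γ α μ)) *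
        (Complex.exp (Complex.I * z.1 * waveFreq γ α μ) * a μ z.2) := by
      rw [← mul_assoc, ← Complex.exp_add]
      ring_nf
    rw [e]
    refine Tendsto.mul_const _ ?_
    have := (NormedSpace.expSeries_div_hasSum_exp
      (Complex.I * z.1 * (waveSymbol γ α μ - waveFreq γ α μ))).tendsto_sum_nat
    rwa [← Complex.exp_eq_exp_ℂ] at this
  refine (Lp.eLpNorm_lim_le_liminf_eLpNorm
    (fun J => Finset.aestronglyMeasurable_sum _ fun j _ => hVm j) _ (ae_of_all _ hlim)).trans ?_
  have hJ : ∀ J : ℕ, eLpNorm (∑ j ∈ Finset.range J, V j) (ENNReal.ofReal q) P ≤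
      ENNReal.ofReal (Real.exp (2 * Real.pi * R)) * (C * X) := fun J => by
    refine (eLpNorm_sum_le (fun j _ => hVm j) hq1).trans ?_
    refine (Finset.sum_le_sum fun j _ => hVle j).trans ?_
    rw [← Finset.sum_mul, ← ENNReal.ofReal_sum_of_nonneg fun j _ => by positivity]
    gcongr
    exact Real.sum_le_exp_of_nonneg (by positivity) J
  refine (liminf_le_liminf (Eventually.of_forall hJ)).trans_eq ?_
  rw [liminf_const, ENNReal.coe_mul, ENNReal.ofReal]
  ring

end FiniteSums

/-! ### Convergence of the spectral series in `L²` -/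

section Evolution

variable {Ω : Set E3} {γ α : ℝ}

/-- Subtracting the real number `waveFreq` leaves the modulus unchanged, so only the bounded
remainder can make the exponential grow. -/
theorem norm_exp_waveSymbol_le {R : ℝ} {μ t : ℝ}
    (hR : ‖waveSymbol γ α μ - waveFreq γ α μ‖ ≤ R) :
    ‖Complex.exp (Complex.I * t * waveSymbol γ α μ)‖ ≤ Real.exp (|t| * R) := by
  rw [Complex.norm_exp]
  refine Real.exp_le_exp.2 ?_
  have h1 : (Complex.I * t * waveSymbol γ α μ).re =
      (Complex.I * t * (waveSymbol γ α μ - waveFreq γ α μ)).re := by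
    simp [mul_assoc]
  rw [h1]
  refine (Complex.re_le_norm _).trans ?_
  rw [norm_mul, norm_mul, Complex.norm_I, one_mul, Complex.norm_real, Real.norm_eq_abs]
  gcongr

/-- `spectralProj Ω {μ} u` vanishes unless `μ ≥ 0`. -/
theorem spectralProj_singleton_of_neg {μ : ℝ} (hμ : μ < 0) (u : L2 Ω) :
    spectralProj Ω {μ} u = 0 :=
  eq_zero_of_mem_eigenspace_of_neg hμ (spectralProj_singleton_mem μ u)

/-- The terms of the square of the Sobolev norm. -/
def sobolevTerm (Ω : Set E3) (s : ℝ) (u : L2 Ω) (μ : ℝ) : ℝ≥0∞ :=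
  ENNReal.ofReal ((1 + μ) ^ s) * ‖spectralProj Ω {μ} u‖ₑ ^ 2

theorem enorm_sq_le_sobolevTerm {s : ℝ} (hs : 0 ≤ s) (u : L2 Ω) (μ : ℝ) :
    ‖spectralProj Ω {μ} u‖ₑ ^ 2 ≤ sobolevTerm Ω s u μ := by
  rcases lt_or_ge μ 0 with h | h
  · simp [spectralProj_singleton_of_neg h]
  · refine le_mul_of_one_le_left' ?_
    rw [← ENNReal.ofReal_one]
    exact ENNReal.ofReal_le_ofReal (Real.one_le_rpow (by linarith) hs)

/-- Ensures that the `tsum` defining the flow is not the default value `0`: the terms are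
orthogonal, and the multipliers are bounded for fixed `t`. -/
theorem hasSum_waveEvol (hα : α ∈ Ioo (0 : ℝ) (1 / 2)) {s : ℝ} (hs : 0 ≤ s) {u : L2 Ω}
    (hu : ∑' μ, sobolevTerm Ω s u μ ≠ ⊤) (t : ℝ) :
    HasSum (fun μ : ℝ => Complex.exp (Complex.I * t * waveSymbol γ α μ) • spectralProj Ω {μ} u)
      (waveEvol Ω γ α t u) := by
  obtain ⟨R, -, hR⟩ := exists_norm_waveSymbol_sub_le γ hα
  have h1 : Summable fun μ : ℝ => ‖spectralProj Ω {μ} u‖ ^ 2 := by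
    have : ∑' μ : ℝ, ‖spectralProj Ω {μ} u‖ₑ ^ 2 ≠ ⊤ :=
      ne_top_of_le_ne_top hu (ENNReal.tsum_le_tsum fun μ => enorm_sq_le_sobolevTerm hs u μ)
    simpa using ENNReal.summable_toReal this
  have h2 : Summable fun μ : ℝ =>
      ‖Complex.exp (Complex.I * t * waveSymbol γ α μ) • spectralProj Ω {μ} u‖ ^ 2 := by
    refine Summable.of_nonneg_of_le (fun μ => by positivity) (fun μ => ?_)
      (h1.mul_left (Real.exp (|t| * R) ^ 2))
    rw [norm_smul, mul_pow]
    rcases lt_or_ge μ 0 with h | h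
    · simp [spectralProj_singleton_of_neg h]
    · gcongr
      exact norm_exp_waveSymbol_le (hR μ h)
  have h3 := (orthogonalFamily_eigenspace.summable_iff_norm_sq_summable (fun μ : ℝ =>
    (⟨Complex.exp (Complex.I * t * waveSymbol γ α μ) • spectralProj Ω {μ} u,
      (eigenspace Ω μ).smul_mem _ (spectralProj_singleton_mem μ u)⟩ : eigenspace Ω μ))).2 h2
  exact h3.hasSum

end Evolution

end FracWave

end

/-! ### Passage to the limit and identification of the flow -/

open FracWave Filter Topology in
theorem proposition2p2 (γ α q δ M : ℝ) (hγ : 0 < γ) (hα : α ∈ Set.Ioo (0 : ℝ) (1 / 2))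
    (hq : 2 ≤ q) (hδ : 0 < δ) :
    ∃ C : ℝ, 0 < C ∧ ∀ Ω : Set FracWave.E3, FracWave.IsSmoothBoundedDomain Ω →
      (∀ l : ℝ, 1 ≤ l → ∀ u : FracWave.L2 Ω,
        eLpNorm (FracWave.clusterProj Ω l u) (ENNReal.ofReal q) (volume.restrict Ω)
          ≤ ENNReal.ofReal (M * l ^ δ * ‖u‖)) →
      ∀ u₀ : FracWave.L2 Ω, FracWave.sobolevNorm Ω (δ + 1 / 2 - 1 / q) u₀ < ⊤ →
        ∃ v : ℝ × FracWave.E3 → ℂ,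
          (∀ᵐ t ∂(volume.restrict (Set.Icc (0 : ℝ) (2 * Real.pi))),
            (fun x => v (t, x)) =ᵐ[volume.restrict Ω] FracWave.waveEvol Ω γ α t u₀) ∧
          MemLp v (ENNReal.ofReal q)
            (volume.restrict (Set.Icc (0 : ℝ) (2 * Real.pi) ×ˢ Ω)) ∧
          eLpNorm v (ENNReal.ofReal q)
              (volume.restrict (Set.Icc (0 : ℝ) (2 * Real.pi) ×ˢ Ω))
            ≤ ENNReal.ofReal C * FracWave.sobolevNorm Ω (δ + 1 / 2 - 1 / q) u₀ := by
  obtain ⟨C, hC⟩ := exists_eLpNorm_waveSum_le γ hα hq hδ M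
  refine ⟨C + 1, by positivity, fun Ω _ hΩ u hu => ?_⟩
  have hs : 0 ≤ δ + 1 / 2 - 1 / q := by
    have : 1 / q ≤ 1 / 2 := one_div_le_one_div_of_le two_pos hq
    linarith
  set s := δ + 1 / 2 - 1 / q
  have hN : sobolevNorm Ω s u = (∑' μ, sobolevTerm Ω s u μ) ^ (1 / 2 : ℝ) := rfl
  have hfin : ∑' μ, sobolevTerm Ω s u μ ≠ ⊤ := by
    intro h
    rw [hN, h, ENNReal.top_rpow_of_pos (by norm_num)] at hu
    exact lt_irrefl _ hu
  have : Fact (1 ≤ ENNReal.ofReal q) :=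
    ⟨by rw [← ENNReal.ofReal_one]; exact ENNReal.ofReal_le_ofReal (by linarith)⟩
  rw [Measure.volume_eq_prod, ← Measure.prod_restrict]
  set κ := volume.restrict (Icc (0 : ℝ) (2 * Real.pi)) with hκ
  set e : ℝ → L2 Ω := fun μ => spectralProj Ω {μ} u with he
  have he0 : ∀ μ, sobolevTerm Ω s u μ = 0 → e μ = 0 := fun μ h => by
    have := enorm_sq_le_sobolevTerm hs u μ
    rw [h] at this
    simpa using this
  have hbound : ∀ F : Finset ℝ, eLpNorm (waveSum γ α F e) (ENNReal.ofReal q)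
      (κ.prod (volume.restrict Ω)) ≤ C * (∑ μ ∈ F, sobolevTerm Ω s u μ) ^ (1 / 2 : ℝ) := by
    intro F
    -- Negative `μ` carry no eigenfunctions; they are dropped because the finite estimate requires
    -- `0 ≤ μ`.
    have h1 : waveSum γ α F e =ᵐ[κ.prod (volume.restrict Ω)]
        waveSum γ α (F.filter (0 ≤ ·)) e := by
      have h0 : ∀ᵐ z ∂(κ.prod (volume.restrict Ω)), ((0 : L2 Ω) : E3 → ℂ) z.2 = 0 :=
        Measure.quasiMeasurePreserving_snd.ae (Lp.coeFn_zero ℂ 2 (volume.restrict Ω))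
      filter_upwards [h0] with z hz
      refine (Finset.sum_subset (Finset.filter_subset _ _) fun μ hμ hμ' => ?_).symm
      have : μ < 0 := by simpa [hμ] using hμ'
      rw [he]
      simp only [spectralProj_singleton_of_neg this, hz, mul_zero]
    rw [eLpNorm_congr_ae h1]
    refine (hC Ω hΩ _ e (fun μ _ => spectralProj_singleton_mem μ u)
      fun μ hμ => (Finset.mem_filter.1 hμ).2).trans ?_
    gcongr
    exact Finset.sum_le_sum_of_subset (Finset.filter_subset _ _)
  have hmem : ∀ μ, MemLp (waveSum γ α {μ} e) (ENNReal.ofReal q)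
      (κ.prod (volume.restrict Ω)) := fun μ => by
    refine ⟨aestronglyMeasurable_waveSum _ _ _ _ _, (hbound {μ}).trans_lt ?_⟩
    refine ENNReal.mul_lt_top (by simp) (ENNReal.rpow_lt_top_of_nonneg (by norm_num) ?_)
    rw [Finset.sum_singleton]
    exact ENNReal.ne_top_of_tsum_ne_top hfin μ
  set X : ℝ → Lp ℂ (ENNReal.ofReal q) (κ.prod (volume.restrict Ω)) := fun μ => (hmem μ).toLp _
    with hX
  have hXsum : ∀ F : Finset ℝ, (∑ μ ∈ F, X μ : Lp ℂ (ENNReal.ofReal q) _)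
      =ᵐ[κ.prod (volume.restrict Ω)] waveSum γ α F e := fun F => by
    refine (coeFn_sum_ae F X).trans ?_
    have : ∀ᵐ z ∂(κ.prod (volume.restrict Ω)), ∀ μ ∈ F, X μ z = waveSum γ α {μ} e z := by
      rw [Finset.eventually_all]
      exact fun μ _ => MemLp.coeFn_toLp _
    filter_upwards [this] with z hz
    rw [Finset.sum_congr rfl hz]
    simp only [waveSum, Finset.sum_singleton]
  have hXnorm : ∀ F : Finset ℝ, ‖∑ μ ∈ F, X μ‖ₑ ≤
      C * (∑ μ ∈ F, sobolevTerm Ω s u μ) ^ (1 / 2 : ℝ) := fun F => by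
    rw [Lp.enorm_def, eLpNorm_congr_ae (hXsum F)]
    exact hbound F
  -- Cauchy criterion: a finite sum avoiding `F` is bounded by the tail of the Sobolev series
  -- outside `F`.
  have hXsummable : Summable X := by
    rw [summable_iff_vanishing_norm]
    intro ε hε
    have h1 : Tendsto (fun F : Finset ℝ => (C : ℝ≥0∞) *
        (∑' μ : { x // x ∉ F }, sobolevTerm Ω s u μ) ^ (1 / 2 : ℝ)) atTop (𝓝 0) := by
      have h2 := ENNReal.tendsto_tsum_compl_atTop_zero hfin
      have h3 := ((ENNReal.continuous_rpow_const (y := 1 / 2)).tendsto 0).comp h2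
      have h4 := ENNReal.Tendsto.const_mul (a := (C : ℝ≥0∞)) h3 (Or.inr (by simp))
      simpa [Function.comp_def] using h4
    obtain ⟨F, hF⟩ := (h1.eventually_lt_const (ENNReal.ofReal_pos.2 hε)).exists
    refine ⟨F, fun G hG => ?_⟩
    rw [← ENNReal.ofReal_lt_ofReal_iff hε, ofReal_norm]
    refine lt_of_le_of_lt ((hXnorm G).trans ?_) hF
    gcongr
    calc ∑ μ ∈ G, sobolevTerm Ω s u μ
        = ∑ μ ∈ G.subtype (· ∉ F), sobolevTerm Ω s u μ := by
          rw [Finset.sum_subtype_of_mem]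
          exact fun μ hμ => Finset.disjoint_left.1 hG hμ
      _ ≤ _ := ENNReal.sum_le_tsum _
  obtain ⟨V, hV⟩ := hXsummable
  have hVnorm : ‖V‖ₑ ≤ C * sobolevNorm Ω s u := by
    refine le_of_tendsto ((continuous_enorm.tendsto V).comp hV) (Eventually.of_forall fun F => ?_)
    refine (hXnorm F).trans ?_
    rw [hN]
    gcongr
    exact ENNReal.sum_le_tsum F
  refine ⟨V, ?_, Lp.memLp V, ?_⟩
  -- A finite sum in `ℝ≥0∞` has countable support, which turns the net of finite sets into a
  -- sequence, as a.e. convergent subsequences require.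
  · set T := Function.support (sobolevTerm Ω s u) with hT
    have : Countable T := (Summable.countable_support_ennreal hfin).to_subtype
    obtain ⟨H, hH⟩ := exists_seq_tendsto (atTop : Filter (Finset T))
    set F : ℕ → Finset ℝ := fun n => (H n).map (Function.Embedding.subtype _) with hF
    have hXT : Tendsto (fun n => ∑ μ ∈ F n, X μ) atTop (𝓝 V) := by
      have h : HasSum (X ∘ ((↑) : T → ℝ)) V := by
        refine (hasSum_subtype_iff_of_support_subset fun μ hμ => ?_).2 hV
        rw [hT, Function.mem_support]
        intro h0
        have := hXnorm {μ}
        simp only [Finset.sum_singleton, h0] at this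
        exact hμ (by simpa using this)
      simpa only [hF, Finset.sum_map, Function.comp_def, Function.Embedding.subtype_apply] using
        h.comp hH
    obtain ⟨ns, hns, hae⟩ := (tendstoInMeasure_of_tendsto_Lp hXT).exists_seq_tendsto_ae
    have hae2 : ∀ᵐ z ∂(κ.prod (volume.restrict Ω)),
        Tendsto (fun i => waveSum γ α (F (ns i)) e z) atTop (𝓝 (V z)) := by
      filter_upwards [hae, ae_all_iff.2 fun i => hXsum (F (ns i))] with z h1 h2
      simpa only [h2] using h1
    filter_upwards [Measure.ae_ae_of_ae_prod hae2] with t ht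
    have hY : Tendsto (fun i => ∑ μ ∈ F (ns i),
        Complex.exp (Complex.I * t * waveSymbol γ α μ) • e μ) atTop (𝓝 (waveEvol Ω γ α t u)) := by
      have h : HasSum ((fun μ : ℝ => Complex.exp (Complex.I * t * waveSymbol γ α μ) • e μ) ∘
          ((↑) : T → ℝ)) (waveEvol Ω γ α t u) := by
        refine (hasSum_subtype_iff_of_support_subset fun μ hμ => ?_).2
          (hasSum_waveEvol hα hs hfin t)
        rw [hT, Function.mem_support]
        intro h0
        exact hμ (by simp [he0 μ h0])
      have h2 := (Tendsto.comp h hH).comp hns.tendsto_atTop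
      simpa only [hF, Finset.sum_map, Function.comp_def, Function.Embedding.subtype_apply] using h2
    -- This subsequence depends on `t`, harmlessly: the space-time sums already converge a.e. along
    -- `ns`, hence along `ms`, and the two limits agree.
    obtain ⟨ms, hms, hY2⟩ := (tendstoInMeasure_of_tendsto_Lp hY).exists_seq_tendsto_ae
    have hYsum : ∀ i, (∑ μ ∈ F (ns i), Complex.exp (Complex.I * t * waveSymbol γ α μ) • e μ : L2 Ω)
        =ᵐ[volume.restrict Ω] fun x => waveSum γ α (F (ns i)) e (t, x) := fun i => by
      refine (coeFn_sum_ae _ _).trans ?_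
      have : ∀ᵐ x ∂(volume.restrict Ω), ∀ μ ∈ F (ns i),
          (Complex.exp (Complex.I * t * waveSymbol γ α μ) • e μ : L2 Ω) x =
            Complex.exp (Complex.I * t * waveSymbol γ α μ) * e μ x := by
        rw [Finset.eventually_all]
        exact fun μ _ => Lp.coeFn_smul _ _
      filter_upwards [this] with x hx
      exact Finset.sum_congr rfl hx
    filter_upwards [ht, hY2, ae_all_iff.2 fun i => hYsum (ms i)] with x h1 h2 h3
    simp only [h3] at h2
    exact tendsto_nhds_unique (h1.comp hms.tendsto_atTop) h2
  · rw [Lp.enorm_def] at hVnorm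
    refine hVnorm.trans ?_
    gcongr
    rw [ENNReal.ofReal_add (by positivity) (by norm_num), ENNReal.ofReal_coe_nnreal]
    exact le_self_add
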